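/- Let $n \ge 0$ and let $\mathcal C_1, \dots, \mathcal C_n$ be essentially small categories equipped with Grothendieck topologies $J_1, \dots, J_n$. On the product category $\mathcal C_1 \times \cdots \times \mathcal C_n$, with projections $p_i$, the topology induced by $J_i$ is the one for which a sieve on $(X_1,\dots,X_n)$ is covering if and only if there is a $J_i$-covering family $(x_k : X_{i,k} \to X_i)_{k\in K}$ such that the sieve contains all the morphisms $(\mathrm{id}_{X_1},\dots,\mathrm{id}_{X_{i-1}}, x_k, \mathrm{id}_{X_{i+1}},\dots,\mathrm{id}_{X_n})$, $k\in K$. Let $J_1\vee\cdots\vee J_n$ be the smallest topology on $\mathcal C_1\times\cdots\times\mathcal C_n$ containing these $n$ induced topologies. Then: (i) A sieve $C$ on an object $(X_1,\dots,X_n)$ is covering for $J_1\vee\cdots\vee J_n$ if and only if the maximal sieve is the unique sieve $C'$ on $(X_1,\dots,X_n)$ such that $C'$ contains $C$ and, for every $i$, $C'$ is $J_i$-closed in the following sense: a morphism $(x_1,\dots,x_n) : (X'_1,\dots,X'_n)\to(X_1,\dots,X_n)$ belongs to $C'$ as soon as there is a $J_i$-covering family $(x_{i,k}: X'_{i,k}\to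 X'_i)_{k\in K}$ for which all the morphisms $(x_1,\dots,x_{i-1}, x_i\circ x_{i,k}, x_{i+1},\dots,x_n)$, $k\in K$, belong to $C'$. (ii) The category $\mathrm{Sh}(\mathcal C_1\times\cdots\times\mathcal C_n,\, J_1\vee\cdots\vee J_n)$ is a topos and, with the morphisms of toposes to the $\mathrm{Sh}(\mathcal C_i,J_i)$ induced by the $p_i$ (whose inverse image is composition with $p_i$ followed by sheafification, and whose direct image is right Kan extension along $p_i$), it is a product of the toposes $\mathrm{Sh}(\mathcal C_i,J_i)$ in the 2-category of toposes: for every topos $\mathcal E$, the functor $$\mathrm{Geom}\bigl(\mathcal E, \mathrm{Sh}(\mathcal C_1\times\cdots\times\mathcal C_n, J_1\vee\cdots\vee J_n)\bigr)\longrightarrow \prod_{i=1}^n \mathrm{Geom}\bigl(\mathcal E,\mathrm{Sh}(\mathcal C_i,J_i)\bigr)$$ given by composition with these morphisms is an equivalence of categories. Here a topos is a category equivalent to the category of sheaves of sets on a small site, $\mathrm{Geom}(\mathcal E,\mathcal F)$ has as objects the adjoint pairs $f^*\dashv f_*$, with $f^*:\mathcal F\to\mathcal E$ preserving finite limits, and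 its morphisms $f\to g$ are the natural transformations $f^*\to g^*$. -/

import Mathlib

open CategoryTheory CategoryTheory.Limits Opposite

universe v u w w'

namespace ToposProduct

/-! ### Toposes and geometric morphisms -/

/-- A (Grothendieck) topos, relative to the category of sets `Type v`: a category equivalent to
the category of sheaves of sets on a small site. -/
def IsTopos (E : Type w) [Category.{w'} E] : Prop :=
  ∃ (D : Type v) (_ : SmallCategory D) (K : GrothendieckTopology D),
    Nonempty (E ≌ Sheaf K (Type v))

/-- Essentially small sites also present toposes. -/
theorem isTopos_sheaf {C : Type u} [Category.{v} C] [EssentiallySmall.{v} C]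
    (J : GrothendieckTopology C) : IsTopos.{v} (Sheaf J (Type v)) :=
  ⟨SmallModel.{v} C, inferInstance, (equivSmallModel.{v} C).inverse.inducedTopology J,
    ⟨(equivSmallModel.{v} C).sheafCongr J _ (Type v)⟩⟩

/-- A morphism of toposes `E ⟶ F`: a pair of adjoint functors `f^* : F ⥤ E`, `f_* : E ⥤ F`
such that `f^*` preserves finite limits. (As a left adjoint `f^*` preserves all colimits.) -/
structure GeomMorph (E : Type*) [Category* E] (F : Type*) [Category* F] where
  inverseImage : F ⥤ E
  directImage : E ⥤ F
  adj : inverseImage ⊣ directImage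
  preservesFiniteLimits : PreservesFiniteLimits inverseImage

namespace GeomMorph

/-- `Geom(E, F)`: a morphism `f ⟶ g` is a natural transformation `f^* ⟶ g^*`. -/
instance {E : Type*} [Category* E] {F : Type*} [Category* F] : Category (GeomMorph E F) :=
  inferInstanceAs (Category (InducedCategory (F ⥤ E) GeomMorph.inverseImage))

/-- The composite `E ⟶ F ⟶ G`. -/
def comp {E : Type*} [Category* E] {F : Type*} [Category* F] {G : Type*} [Category* G]
    (f : GeomMorph E F) (g : GeomMorph F G) : GeomMorph E G where
  inverseImage := g.inverseImage ⋙ f.inverseImage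
  directImage := f.directImage ⋙ g.directImage
  adj := g.adj.comp f.adj
  preservesFiniteLimits :=
    haveI := f.preservesFiniteLimits
    haveI := g.preservesFiniteLimits
    comp_preservesFiniteLimits _ _

/-- The functor `Geom(E, F) ⥤ Geom(E, G)` of composition with `g : F ⟶ G`. -/
def postcomp (E : Type*) [Category* E] {F : Type*} [Category* F] {G : Type*} [Category* G]
    (g : GeomMorph F G) : GeomMorph E F ⥤ GeomMorph E G where
  obj f := f.comp g
  map α := ⟨Functor.whiskerLeft g.inverseImage α.hom⟩

end GeomMorph

/-! ### The geometric morphism induced by a cocontinuous functor -/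

section Cocontinuous

variable {C : Type u} [Category.{v} C] [EssentiallySmall.{v} C]

theorem hasSheafify (J : GrothendieckTopology C) : HasSheafify J (Type v) :=
  hasSheafifyEssentiallySmallSite.{v} J (Type v)

theorem hasRan {D : Type w} [Category.{v} D] (p : C ⥤ D) (F : Cᵒᵖ ⥤ Type v) :
    p.op.HasPointwiseRightKanExtension F := fun X =>
  haveI : HasLimitsOfShape (StructuredArrow X p.op) (Type v) :=
    hasLimitsOfShape_of_essentiallySmall.{v} _ _
  inferInstanceAs (HasLimit _)

/-- The morphism of toposes `Sh(C, J) ⟶ Sh(D, K)` induced by a functor `p : C ⥤ D` which lifts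
`K`-covering sieves to `J`-covering ones: `p^*` is composition with `p` followed by
`J`-sheafification, and `p_*` is the restriction to sheaves of right Kan extension along `p`. -/
noncomputable def geomMorphOfCocontinuous {D : Type w} [Category.{v} D]
    (p : C ⥤ D) (J : GrothendieckTopology C) (K : GrothendieckTopology D)
    [p.IsCocontinuous J K] :
    GeomMorph (Sheaf J (Type v)) (Sheaf K (Type v)) :=
  haveI := hasSheafify J
  haveI := hasRan p
  { inverseImage := sheafToPresheaf K (Type v) ⋙ (Functor.whiskeringLeft _ _ (Type v)).obj p.op ⋙
      presheafToSheaf J (Type v)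
    directImage := p.sheafPushforwardCocontinuous (Type v) J K
    adj := ((p.op.ranAdjunction (Type v)).comp
        (sheafificationAdjunction J (Type v))).restrictFullyFaithful
      (fullyFaithfulSheafToPresheaf K (Type v)) (Functor.FullyFaithful.id _)
      (Iso.refl _) (Iso.refl _)
    preservesFiniteLimits := by
      have : PreservesFiniteLimits (sheafToPresheaf K (Type v)) := ⟨fun _ _ _ => inferInstance⟩
      have : PreservesFiniteLimits ((Functor.whiskeringLeft _ _ (Type v)).obj p.op) :=
        ⟨fun _ _ _ => inferInstance⟩
      have : PreservesFiniteLimits (presheafToSheaf J (Type v)) := inferInstance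
      have := comp_preservesFiniteLimits ((Functor.whiskeringLeft _ _ (Type v)).obj p.op)
        (presheafToSheaf J (Type v))
      exact comp_preservesFiniteLimits _ _ }

end Cocontinuous

/-! ### Topologies on a product of categories -/

section Product

variable {n : ℕ} {C : Fin n → Type u} [∀ i, Category.{v} (C i)]

instance [∀ i, EssentiallySmall.{v} (C i)] : EssentiallySmall.{v} (∀ i, C i) :=
  ⟨(∀ i, SmallModel.{v} (C i)), inferInstance,
    ⟨CategoryTheory.Equivalence.pi fun i => equivSmallModel.{v} (C i)⟩⟩

/-- For `f : Y ⟶ X i`, the morphism `(id, …, id, f, id, …, id)` with `f` in position `i`, from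
`(X 1, …, X (i - 1), Y, X (i + 1), …, X n)` to `X`. -/
def single (X : ∀ i, C i) (i : Fin n) {Y : C i} (f : Y ⟶ X i) : Function.update X i Y ⟶ X :=
  fun j =>
    if h : j = i then
      Eq.rec (motive := fun j _ => Function.update X i Y j ⟶ X j)
        (eqToHom (Function.update_self i Y X) ≫ f) h.symm
    else eqToHom (Function.update_of_ne h Y X)

@[simp]
theorem single_self (X : ∀ i, C i) (i : Fin n) {Y : C i} (f : Y ⟶ X i) :
    single X i f i = eqToHom (Function.update_self i Y X) ≫ f := by
  simp [single]

@[simp]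
theorem single_of_ne (X : ∀ i, C i) (i : Fin n) {Y : C i} (f : Y ⟶ X i) {j : Fin n} (h : j ≠ i) :
    single X i f j = eqToHom (Function.update_of_ne h Y X) := by
  simp [single, h]

/-- A morphism whose `i`-th component factors through `f` factors through `single X i f`. -/
theorem exists_factor_single {X Z : ∀ i, C i} (g : Z ⟶ X) (i : Fin n) {Y : C i} (f : Y ⟶ X i)
    (e : Z i ⟶ Y) (h : g i = e ≫ f) :
    ∃ k : Z ⟶ Function.update X i Y, g = k ≫ single X i f ∧
      k i = e ≫ eqToHom (Function.update_self i Y X).symm := by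
  refine ⟨fun j => if hj : j = i then
      Eq.rec (motive := fun j _ => Z j ⟶ Function.update X i Y j)
        (e ≫ eqToHom (Function.update_self i Y X).symm) hj.symm
    else g j ≫ eqToHom (Function.update_of_ne hj Y X).symm, ?_, by simp⟩
  funext j
  by_cases hj : j = i
  · subst hj
    simp [h]
  · simp [hj]

/-- The sieve of those `f : Y ⟶ X i` with `(id, …, f, …, id) ∈ S`. -/
def sliceSieve {X : ∀ i, C i} (S : Sieve X) (i : Fin n) : Sieve (X i) where
  arrows Y f := S (single X i f)
  downward_closed {Y Z f} hf g := by
    obtain ⟨k, hk, -⟩ := exists_factor_single (single X i (g ≫ f)) i f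
      (eqToHom (Function.update_self i Z X) ≫ g) (by simp)
    rw [hk]
    exact S.downward_closed hf k

theorem mem_of_sliceSieve {X : ∀ i, C i} {S : Sieve X} {i : Fin n} {Z : ∀ i, C i} {g : Z ⟶ X}
    {Y : C i} {f : Y ⟶ X i} (hf : sliceSieve S i f) (e : Z i ⟶ Y) (h : g i = e ≫ f) : S g := by
  obtain ⟨k, rfl, -⟩ := exists_factor_single g i f e h
  exact S.downward_closed hf k

theorem exists_presieve_iff (J : ∀ i, GrothendieckTopology (C i)) (i : Fin n) {X : ∀ i, C i}
    (S : Sieve X) :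
    (∃ R : Presieve (X i), Sieve.generate R ∈ J i (X i) ∧
        ∀ ⦃Y : C i⦄ (f : Y ⟶ X i), R f → S (single X i f)) ↔
      sliceSieve S i ∈ J i (X i) := by
  constructor
  · rintro ⟨R, hR, h⟩
    exact (J i).superset_covering ((Sieve.generate_le_iff _ _).2 fun Y f hf => h f hf) hR
  · intro h
    exact ⟨(sliceSieve S i).arrows, by simpa using h, fun Y f hf => hf⟩

/-- The topology on `C 1 × ⋯ × C n` induced by the topology `J i` of `C i`: a sieve on `X` covers
if it contains the morphisms `(id, …, id, f, id, …, id)` for all members `f` of some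
`J i`-covering family of `X i`. -/
def inducedTopology (J : ∀ i, GrothendieckTopology (C i)) (i : Fin n) :
    GrothendieckTopology (∀ i, C i) where
  sieves X := {S | ∃ R : Presieve (X i), Sieve.generate R ∈ J i (X i) ∧
    ∀ ⦃Y : C i⦄ (f : Y ⟶ X i), R f → S (single X i f)}
  top_mem' X := ⟨⊤, by simp, fun _ _ _ => trivial⟩
  pullback_stable' X Z S g hS := by
    rw [Set.mem_ofPred_eq, exists_presieve_iff] at hS ⊢
    refine (J i).superset_covering ?_ ((J i).pullback_stable (g i) hS)
    intro Y f hf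
    exact mem_of_sliceSieve hf (eqToHom (Function.update_self i Y Z)) (by simp)
  transitive' X S hS T hT := by
    rw [Set.mem_ofPred_eq, exists_presieve_iff] at hS ⊢
    refine (J i).transitive hS _ fun Y f hf => ?_
    have h := hT hf
    rw [Set.mem_ofPred_eq, exists_presieve_iff] at h
    have h' := (J i).pullback_stable (eqToHom (Function.update_self i Y X).symm) h
    refine (J i).superset_covering ?_ h'
    intro Z g hg
    obtain ⟨k, hk, hki⟩ := exists_factor_single (single X i (g ≫ f)) i f
      (eqToHom (Function.update_self i Z X) ≫ g) (by simp)
    change T (single X i (g ≫ f))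
    rw [hk]
    exact mem_of_sliceSieve (S := Sieve.pullback (single X i f) T) hg
      (eqToHom (Function.update_self i Z X)) (by simp [hki])

/-- The join `J 1 ∨ ⋯ ∨ J n`: the smallest topology on `C 1 × ⋯ × C n` containing the topologies
induced by all the `J i`. -/
def joinTopology (J : ∀ i, GrothendieckTopology (C i)) : GrothendieckTopology (∀ i, C i) :=
  sInf {T | ∀ i, inducedTopology J i ≤ T}

/-- A sieve `S` on `X` is `J i`-closed if it contains `x : X' ⟶ X` as soon as, for the members `f`
of some `J i`-covering family of `X' i`, it contains all the composites
`(x 1, …, x (i - 1), f ≫ x i, x (i + 1), …, x n)` of `(id, …, id, f, id, …, id)` and `x`. -/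
def IsClosedAt (J : ∀ i, GrothendieckTopology (C i)) (i : Fin n) {X : ∀ i, C i}
    (S : Sieve X) : Prop :=
  ∀ ⦃X' : ∀ i, C i⦄ (x : X' ⟶ X),
    (∃ R : Presieve (X' i), Sieve.generate R ∈ J i (X' i) ∧
      ∀ ⦃Y : C i⦄ (f : Y ⟶ X' i), R f → S (single X' i f ≫ x)) → S x

instance (J : ∀ i, GrothendieckTopology (C i)) (i : Fin n) :
    (Pi.eval C i).IsCocontinuous (joinTopology J) (J i) where
  cover_lift {X S} hS := by
    rw [joinTopology, GrothendieckTopology.mem_sInf]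
    intro T hT
    refine hT i X ⟨S.arrows, (congrArg (· ∈ J i (X i)) (Sieve.generate_sieve S)).mpr hS, fun Y f hf => ?_⟩
    change S (single X i f i)
    rw [single_self]
    exact S.downward_closed hf _

/-- The morphism of toposes `Sh(C 1 × ⋯ × C n, J 1 ∨ ⋯ ∨ J n) ⟶ Sh(C i, J i)` induced by the
projection functor `C 1 × ⋯ × C n ⥤ C i`. -/
noncomputable def projection [∀ i, EssentiallySmall.{v} (C i)]
    (J : ∀ i, GrothendieckTopology (C i)) (i : Fin n) :
    GeomMorph (Sheaf (joinTopology J) (Type v)) (Sheaf (J i) (Type v)) :=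
  geomMorphOfCocontinuous (Pi.eval C i) (joinTopology J) (J i)

end Product

end ToposProduct

namespace ToposProduct

/-! ### Left adjoint functors out of a category of presheaves -/

section LeftAdjoint

variable {A : Type u} [Category.{v} A] {E : Type w} [Category.{w'} E]

/-! For (i), the sieves whose every pullback generates the maximal sieve under the `J i`-closure
operations form a topology containing the induced ones, hence the join. Conversely, the closure of a
sieve for the join is `J i`-closed for each `i`, so if it must be maximal then the sieve covers
(`mem_joinTopology_iff`).

For (ii), a morphism of toposes to sheaves on a site amounts to a left exact left adjoint on
presheaves whose right adjoint takes values in sheaves. Replace `E` by sheaves on a small site `(D,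
K)`. Morphisms to the factors give left exact left adjoints `G i`. The functor sending `X` to the
presheaf product of the `G i (yoneda (X i))` extends to a left adjoint `L` on presheaves, with
values in presheaves on `D`, where it can be handled by elements. Each `G i` is locally flat on
representables, so their finite product is too, and a local form of Diaconescu's argument makes `L`
followed by sheafification left exact (`LocallyFlat.preservesFiniteLimits`). It inverts covering
sieves of each induced topology, so its right adjoint lands in sheaves for the join
(`isSheaf_joinTopology`). It restricts to `G i` along the projections
(`nonempty_pullbackEval_comp_iso`), which gives essential surjectivity.

Full faithfulness holds because a representable on the product category is the finite product of the
pullbacks of the representables of its coordinates: a transformation from a left adjoint to a left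
exact functor is the same as its restrictions along the projections
(`exists_natTrans_of_pullbackEval`). Sheafification is a localization, so nothing is lost by working
with presheaves. -/

theorem map_yonedaEquiv_symm {P : Aᵒᵖ ⥤ Type v} {X Z : A} (g : Z ⟶ X) (p : P.obj (op X)) :
    yoneda.map g ≫ yonedaEquiv.symm p = yonedaEquiv.symm (P.map g.op p) := by
  rw [yonedaEquiv_symm_map, Quiver.Hom.unop_op]

theorem yonedaEquiv_symm_comp {P Q : Aᵒᵖ ⥤ Type v} (φ : P ⟶ Q) {X : A} (p : P.obj (op X)) :
    yonedaEquiv.symm p ≫ φ = yonedaEquiv.symm (φ.app (op X) p) := by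
  apply yonedaEquiv.injective
  simp [yonedaEquiv_comp]

theorem hom_ext_of_isLeftAdjoint {L : (Aᵒᵖ ⥤ Type v) ⥤ E} [L.IsLeftAdjoint]
    {P : Aᵒᵖ ⥤ Type v} {M : E} {a b : L.obj P ⟶ M}
    (h : ∀ (X : A) (p : P.obj (op X)),
      L.map (yonedaEquiv.symm p) ≫ a = L.map (yonedaEquiv.symm p) ≫ b) : a = b := by
  let adj := Adjunction.ofIsLeftAdjoint L
  apply (adj.homEquiv _ _).injective
  ext X p
  have := congrArg (fun k => yonedaEquiv (adj.homEquiv _ _ k)) (h X.unop p)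
  simpa only [Adjunction.homEquiv_naturality_left, yonedaEquiv_comp,
    Equiv.apply_symm_apply] using! this

/-- Transposed across the adjunction, a compatible family is exactly a natural transformation from
`P` to the right adjoint applied to `M`. -/
theorem exists_desc_of_isLeftAdjoint (L : (Aᵒᵖ ⥤ Type v) ⥤ E) [L.IsLeftAdjoint]
    {P : Aᵒᵖ ⥤ Type v} {M : E} (a : ∀ X : A, P.obj (op X) → (L.obj (yoneda.obj X) ⟶ M))
    (ha : ∀ {X Z : A} (g : Z ⟶ X) (p : P.obj (op X)),
      L.map (yoneda.map g) ≫ a X p = a Z (P.map g.op p)) :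
    ∃ l : L.obj P ⟶ M, ∀ (X : A) (p : P.obj (op X)),
      L.map (yonedaEquiv.symm p) ≫ l = a X p := by
  let adj := Adjunction.ofIsLeftAdjoint L
  let k : P ⟶ L.rightAdjoint.obj M :=
    { app X := ↾fun p => yonedaEquiv (adj.homEquiv _ _ (a X.unop p))
      naturality X Z g := by
        ext p
        have := ha g.unop p
        simp only [Quiver.Hom.op_unop] at this
        change yonedaEquiv (adj.homEquiv _ _ (a Z.unop (P.map g p))) =
          (L.rightAdjoint.obj M).map g (yonedaEquiv (adj.homEquiv _ _ (a X.unop p)))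
        rw [← this, Adjunction.homEquiv_naturality_left]
        exact (yonedaEquiv_naturality _ g.unop).symm }
  refine ⟨(adj.homEquiv _ _).symm k, fun X p => ?_⟩
  rw [← Adjunction.homEquiv_naturality_left_symm, Equiv.symm_apply_eq, yonedaEquiv_symm_comp]
  simp [k]

/-- `L.obj P` is the colimit of `L` over the elements of `P`, so `γ` dictates the component at `P`;
nothing is needed of `L'`. -/
theorem exists_natTrans_of_isLeftAdjoint {L L' : (Aᵒᵖ ⥤ Type v) ⥤ E} [L.IsLeftAdjoint]
    (γ : yoneda ⋙ L ⟶ yoneda ⋙ L') :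
    ∃ γ' : L ⟶ L', ∀ X, γ'.app (yoneda.obj X) = γ.app X := by
  have h (P : Aᵒᵖ ⥤ Type v) := exists_desc_of_isLeftAdjoint L
    (P := P) (M := L'.obj P) (fun X p => γ.app X ≫ L'.map (yonedaEquiv.symm p)) (by
      intro X Z g p
      have := γ.naturality g
      dsimp at this
      rw [reassoc_of% this, ← L'.map_comp, map_yonedaEquiv_symm])
  choose l hl using h
  refine ⟨{ app := l, naturality := fun P Q φ => ?_ }, fun X => ?_⟩
  · apply hom_ext_of_isLeftAdjoint
    intro X p
    rw [← L.map_comp_assoc, yonedaEquiv_symm_comp, hl, reassoc_of% hl P X p, ← L'.map_comp,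
      yonedaEquiv_symm_comp]
  · have := hl (yoneda.obj X) X (yonedaEquiv (𝟙 _))
    simpa using this

theorem natTrans_ext_of_isLeftAdjoint {L L' : (Aᵒᵖ ⥤ Type v) ⥤ E} [L.IsLeftAdjoint]
    {α β : L ⟶ L'} (h : ∀ X, α.app (yoneda.obj X) = β.app (yoneda.obj X)) : α = β := by
  ext P
  apply hom_ext_of_isLeftAdjoint
  intro X p
  rw [α.naturality, β.naturality, h]

end LeftAdjoint

/-! ### Presheaf-valued extensions along the Yoneda embedding and their elements -/

section Presheaf

variable {A : Type u} [Category.{v} A] {D : Type v} [SmallCategory D]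

/-- This is the pointwise left Kan extension along Yoneda; essential smallness of `A` makes the
indexing categories of elements essentially small. -/
theorem exists_leftAdjoint_extension [EssentiallySmall.{v} A] (F : A ⥤ Dᵒᵖ ⥤ Type v) :
    ∃ L : (Aᵒᵖ ⥤ Type v) ⥤ Dᵒᵖ ⥤ Type v, L.IsLeftAdjoint ∧ Nonempty (F ≅ yoneda ⋙ L) := by
  have : (uliftYoneda.{v} : A ⥤ _).HasPointwiseLeftKanExtension F := fun P => by
    have : EssentiallySmall.{v} (CostructuredArrow (uliftYoneda.{v} : A ⥤ _) P) :=
      essentiallySmall_of_fully_faithful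
        (CategoryOfElements.costructuredArrowULiftYonedaEquivalence.{v} P).inverse
    have : HasColimitsOfShape (CostructuredArrow (uliftYoneda.{v} : A ⥤ _) P) (Dᵒᵖ ⥤ Type v) :=
      hasColimitsOfShape_of_essentiallySmall.{v} _ _
    exact inferInstanceAs (HasColimit _)
  let L := (uliftYoneda.{v} : A ⥤ _).leftKanExtension F
  let α := (uliftYoneda.{v} : A ⥤ _).leftKanExtensionUnit F
  refine ⟨L, (Presheaf.uliftYonedaAdjunction L α).isLeftAdjoint, ⟨asIso α ≪≫ ?_⟩⟩
  exact Functor.isoWhiskerRight (NatIso.ofComponents fun X =>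
    NatIso.ofComponents fun Y => Equiv.ulift.toIso) L

variable (L : (Aᵒᵖ ⥤ Type v) ⥤ Dᵒᵖ ⥤ Type v) [L.IsLeftAdjoint]

theorem exists_map_yonedaEquiv_symm_eq {P : Aᵒᵖ ⥤ Type v} {d : Dᵒᵖ} (x : (L.obj P).obj d) :
    ∃ (X : A) (p : P.obj (op X)) (t : (L.obj (yoneda.obj X)).obj d),
      (L.map (yonedaEquiv.symm p)).app d t = x := by
  have : PreservesColimitsOfSize.{v, max u v} L :=
    (Adjunction.ofIsLeftAdjoint L).leftAdjoint_preservesColimits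
  obtain ⟨j, t, h⟩ := Types.jointly_surjective_of_isColimit
    (isColimitOfPreserves ((evaluation _ _).obj d)
      (isColimitOfPreserves L (Presheaf.isColimitTautologicalCocone P))) x
  refine ⟨j.left, yonedaEquiv j.hom, t, ?_⟩
  simpa using! h

/-- An induction principle for equality in the value at a presheaf of a functor
which commutes with colimits. -/
theorem rel_of_map_yonedaEquiv_symm_eq {P : Aᵒᵖ ⥤ Type v} {d : Dᵒᵖ}
    (R : ∀ {X Z : A}, P.obj (op X) → (L.obj (yoneda.obj X)).obj d →
      P.obj (op Z) → (L.obj (yoneda.obj Z)).obj d → Prop)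
    (refl : ∀ {X : A} (p : P.obj (op X)) (t : (L.obj (yoneda.obj X)).obj d), R p t p t)
    (map : ∀ {X Z : A} (g : Z ⟶ X) (p : P.obj (op X)) (t : (L.obj (yoneda.obj Z)).obj d),
      R (P.map g.op p) t p ((L.map (yoneda.map g)).app d t))
    (symm : ∀ {X Z : A} {p : P.obj (op X)} {t : (L.obj (yoneda.obj X)).obj d}
      {q : P.obj (op Z)} {s : (L.obj (yoneda.obj Z)).obj d}, R p t q s → R q s p t)
    (trans : ∀ {X Y Z : A} {p : P.obj (op X)} {t : (L.obj (yoneda.obj X)).obj d}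
      {q : P.obj (op Y)} {s : (L.obj (yoneda.obj Y)).obj d}
      {p' : P.obj (op Z)} {t' : (L.obj (yoneda.obj Z)).obj d},
      R p t q s → R q s p' t' → R p t p' t')
    {X Z : A} {p : P.obj (op X)} {t : (L.obj (yoneda.obj X)).obj d}
    {q : P.obj (op Z)} {s : (L.obj (yoneda.obj Z)).obj d}
    (h : (L.map (yonedaEquiv.symm p)).app d t = (L.map (yonedaEquiv.symm q)).app d s) :
    R p t q s := by
  have : PreservesColimitsOfSize.{v, max u v} L :=
    (Adjunction.ofIsLeftAdjoint L).leftAdjoint_preservesColimits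
  have hc := isColimitOfPreserves ((evaluation _ _).obj d)
      (isColimitOfPreserves L (Presheaf.isColimitTautologicalCocone P))
  -- The category of elements of `P` may be large, so the colimit exists only because `hc` exhibits
  -- one.
  have := HasColimit.mk ⟨_, hc⟩
  let R' (x y : Σ j, (((CostructuredArrow.proj yoneda P ⋙ yoneda) ⋙ L) ⋙
      (evaluation _ _).obj d).obj j) : Prop :=
    R (yonedaEquiv x.1.hom) x.2 (yonedaEquiv y.1.hom) y.2
  let j : CostructuredArrow yoneda P := .mk (yonedaEquiv.symm p)
  let k : CostructuredArrow yoneda P := .mk (yonedaEquiv.symm q)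
  have key := Types.colimit_eq (j := j) (j' := k) (x := t) (x' := s)
    (F := ((CostructuredArrow.proj yoneda P ⋙ yoneda) ⋙ L) ⋙ (evaluation _ _).obj d) (by
      let e := hc.coconePointUniqueUpToIso (colimit.isColimit _)
      have h₁ := ConcreteCategory.congr_hom
        (hc.comp_coconePointUniqueUpToIso_hom (colimit.isColimit _) j) t
      have h₂ := ConcreteCategory.congr_hom
        (hc.comp_coconePointUniqueUpToIso_hom (colimit.isColimit _) k) s
      refine h₁.symm.trans (Eq.trans ?_ h₂)
      exact congrArg (fun z => e.hom z) h)
  -- Equality in a colimit of sets is the equivalence relation generated by the transition maps.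
  suffices ∀ x y, Relation.EqvGen _ x y → R' x y by simpa [R', j, k] using this _ _ key
  intro x y hxy
  induction hxy with
  | rel x y h =>
    obtain ⟨f, hf⟩ := h
    have h₁ := map f.left (yonedaEquiv y.1.hom) x.2
    have h₂ : P.map f.left.op (yonedaEquiv y.1.hom) = yonedaEquiv x.1.hom := by
      rw [yonedaEquiv_naturality]
      exact congrArg _ (CostructuredArrow.w f)
    rw [h₂] at h₁
    dsimp only [R']
    rw [hf]
    exact h₁
  | refl x => exact refl _ _
  | symm x y _ h => exact symm h
  | trans x y z _ _ h₁ h₂ => exact trans h₁ h₂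

end Presheaf

/-! ### Properties which hold locally -/

section Locally

variable {D : Type v} [SmallCategory D] (K : GrothendieckTopology D)

/-- A property of morphisms to `d` holds locally if it holds on a covering sieve. -/
def Locally {d : D} (Q : ∀ ⦃e : D⦄, (e ⟶ d) → Prop) : Prop :=
  ∃ S ∈ K d, ∀ ⦃e : D⦄ (f : e ⟶ d), S f → Q f

variable {K}

theorem Locally.of_forall {d : D} {Q : ∀ ⦃e : D⦄, (e ⟶ d) → Prop} (h : ∀ ⦃e⦄ (f : e ⟶ d), Q f) :
    Locally K Q :=
  ⟨⊤, K.top_mem d, fun _ f _ => h f⟩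

theorem Locally.mono {d : D} {Q Q' : ∀ ⦃e : D⦄, (e ⟶ d) → Prop} (h : Locally K Q)
    (hQ : ∀ ⦃e⦄ (f : e ⟶ d), Q f → Q' f) : Locally K Q' := by
  obtain ⟨S, hS, h⟩ := h
  exact ⟨S, hS, fun e f hf => hQ f (h f hf)⟩

theorem Locally.and {d : D} {Q Q' : ∀ ⦃e : D⦄, (e ⟶ d) → Prop} (h : Locally K Q)
    (h' : Locally K Q') : Locally K fun _ f => Q f ∧ Q' f := by
  obtain ⟨S, hS, h⟩ := h
  obtain ⟨S', hS', h'⟩ := h'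
  exact ⟨S ⊓ S', K.intersection_covering hS hS', fun e f hf => ⟨h f hf.1, h' f hf.2⟩⟩

theorem Locally.bind {d : D} {Q Q' : ∀ ⦃e : D⦄, (e ⟶ d) → Prop} (h : Locally K Q)
    (hQ : ∀ ⦃e⦄ (f : e ⟶ d), Q f → Locally K fun _ g => Q' (g ≫ f)) : Locally K Q' := by
  obtain ⟨S, hS, h⟩ := h
  choose T hT hT' using fun e f (hf : S f) => hQ f (h (e := e) f hf)
  refine ⟨Sieve.bind S.arrows fun e f hf => T e f hf,
    K.bind_covering hS fun e f hf => hT e f hf, ?_⟩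
  rintro e f ⟨e', g, k, hk, hg, rfl⟩
  exact hT' _ _ hk g hg

/-- A finite intersection of covering sieves covers. Finiteness of the number of factors enters
here. -/
theorem Locally.forall {d : D} {ι : Type*} [Finite ι] {Q : ι → ∀ ⦃e : D⦄, (e ⟶ d) → Prop}
    (h : ∀ i, Locally K (Q i)) : Locally K fun _ f => ∀ i, Q i f := by
  choose S hS h using h
  refine ⟨⨅ i, S i, ?_, fun e f hf i => h i f ?_⟩
  · have := Fintype.ofFinite ι
    have (s : Finset ι) : s.inf S ∈ K d := by
      classical
      induction s using Finset.induction_on with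
      | empty => exact K.top_mem d
      | insert a s _ ih =>
        rw [Finset.inf_insert]
        exact K.intersection_covering (hS a) ih
    simpa [Finset.inf_univ_eq_iInf] using this Finset.univ
  · exact iInf_le S i _ hf

theorem isLocallySurjective_iff_locally {P Q : Dᵒᵖ ⥤ Type v} (φ : P ⟶ Q) :
    Presheaf.IsLocallySurjective K φ ↔ ∀ (d : D) (x : Q.obj (op d)),
      Locally K fun e f => ∃ y : P.obj (op e), φ.app _ y = Q.map f.op x :=
  ⟨fun _ _ x => ⟨_, Presheaf.imageSieve_mem K φ x, fun _ _ ⟨y, h⟩ => ⟨y, h⟩⟩,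
    fun h => ⟨fun x => by
      obtain ⟨S, hS, h⟩ := h _ x
      exact K.superset_covering (fun e f hf => h f hf) hS⟩⟩

theorem isLocallyInjective_iff_locally {P Q : Dᵒᵖ ⥤ Type v} (φ : P ⟶ Q) :
    Presheaf.IsLocallyInjective K φ ↔ ∀ (d : D) (x y : P.obj (op d)),
      φ.app _ x = φ.app _ y → Locally K fun _ f => P.map f.op x = P.map f.op y :=
  ⟨fun _ _ x y h => ⟨_, Presheaf.equalizerSieve_mem K φ x y h, fun _ _ h => by exact h⟩,
    fun h => ⟨fun {X} x y hxy => by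
      obtain ⟨S, hS, h⟩ := h X.unop x y hxy
      exact K.superset_covering (fun e f hf => h f hf) hS⟩⟩

end Locally

/-! ### Locally flat functors -/

section LocallyFlat

variable {A : Type u} [Category.{v} A] {D : Type v} [SmallCategory D]
  (K : GrothendieckTopology D)

/-- A functor `F` from `A` to presheaves on `D` is locally flat if, locally on `D`,
the categories of elements of the functors `a ↦ F(a)(d)` are cofiltered. -/
structure LocallyFlat (F : A ⥤ Dᵒᵖ ⥤ Type v) : Prop where
  exists_obj (d : D) : Locally K fun e (_ : e ⟶ d) => ∃ a : A, Nonempty ((F.obj a).obj (op e))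
  exists_span {d : D} {a b : A} (s : (F.obj a).obj (op d)) (t : (F.obj b).obj (op d)) :
    Locally K fun e (f : e ⟶ d) => ∃ (c : A) (g : c ⟶ a) (h : c ⟶ b) (r : (F.obj c).obj (op e)),
      (F.map g).app _ r = (F.obj a).map f.op s ∧ (F.map h).app _ r = (F.obj b).map f.op t
  exists_eq {d : D} {a b : A} (g h : a ⟶ b) (t : (F.obj a).obj (op d))
    (ht : (F.map g).app _ t = (F.map h).app _ t) :
    Locally K fun e (f : e ⟶ d) => ∃ (c : A) (k : c ⟶ a) (r : (F.obj c).obj (op e)),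
      k ≫ g = k ≫ h ∧ (F.map k).app _ r = (F.obj a).map f.op t

variable {K}

theorem app_map_app {F G : A ⥤ Dᵒᵖ ⥤ Type v} (α : F ⟶ G) {a b : A} (g : a ⟶ b) {d : Dᵒᵖ}
    (t : (F.obj a).obj d) :
    (α.app b).app d ((F.map g).app d t) = (G.map g).app d ((α.app a).app d t) :=
  ConcreteCategory.congr_hom (NatTrans.congr_app (α.naturality g) d) t

theorem hom_inv_app_app {F G : A ⥤ Dᵒᵖ ⥤ Type v} (e : F ≅ G) {a : A} {d : Dᵒᵖ}
    (t : (G.obj a).obj d) : (e.hom.app a).app d ((e.inv.app a).app d t) = t :=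
  ConcreteCategory.congr_hom (NatTrans.congr_app (e.inv_hom_id_app a) d) t

theorem inv_hom_app_app {F G : A ⥤ Dᵒᵖ ⥤ Type v} (e : F ≅ G) {a : A} {d : Dᵒᵖ}
    (t : (F.obj a).obj d) : (e.inv.app a).app d ((e.hom.app a).app d t) = t :=
  hom_inv_app_app e.symm t

theorem LocallyFlat.of_iso {F G : A ⥤ Dᵒᵖ ⥤ Type v} (hF : LocallyFlat K F) (e : F ≅ G) :
    LocallyFlat K G where
  exists_obj d := (hF.exists_obj d).mono fun _ _ ⟨a, ⟨t⟩⟩ => ⟨a, ⟨(e.hom.app a).app _ t⟩⟩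
  exists_span {d a b} s t := by
    refine (hF.exists_span ((e.inv.app a).app _ s) ((e.inv.app b).app _ t)).mono ?_
    rintro x f ⟨c, g, h, r, h₁, h₂⟩
    refine ⟨c, g, h, (e.hom.app c).app _ r, ?_, ?_⟩
    · rw [← app_map_app, h₁, NatTrans.naturality_apply, hom_inv_app_app]
    · rw [← app_map_app, h₂, NatTrans.naturality_apply, hom_inv_app_app]
  exists_eq {d a b} g h t ht := by
    refine (hF.exists_eq g h ((e.inv.app a).app _ t) ?_).mono ?_
    · rw [← app_map_app, ht, app_map_app]
    · rintro x f ⟨c, k, r, h₁, h₂⟩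
      refine ⟨c, k, (e.hom.app c).app _ r, h₁, ?_⟩
      rw [← app_map_app, h₂, NatTrans.naturality_apply, hom_inv_app_app]

/-- Take a span over `s` and `t`, then equalize its two composites to `c`. This is what allows spans
to be composed locally. -/
theorem LocallyFlat.exists_cospan {F : A ⥤ Dᵒᵖ ⥤ Type v} (hF : LocallyFlat K F) {d : D}
    {a b c : A} (g : a ⟶ c) (h : b ⟶ c) (s : (F.obj a).obj (op d)) (t : (F.obj b).obj (op d))
    (hst : (F.map g).app _ s = (F.map h).app _ t) :
    Locally K fun e (f : e ⟶ d) =>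
      ∃ (x : A) (k : x ⟶ a) (l : x ⟶ b) (r : (F.obj x).obj (op e)),
        k ≫ g = l ≫ h ∧ (F.map k).app _ r = (F.obj a).map f.op s ∧
          (F.map l).app _ r = (F.obj b).map f.op t := by
  refine (hF.exists_span s t).bind ?_
  rintro e f ⟨x, k, l, r, h₁, h₂⟩
  refine (hF.exists_eq (k ≫ g) (l ≫ h) r ?_).mono ?_
  · simp only [Functor.map_comp, NatTrans.comp_app, comp_apply, h₁, h₂]
    rw [NatTrans.naturality_apply, NatTrans.naturality_apply, hst]
  · rintro e' f' ⟨y, m, r', h₃, h₄⟩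
    refine ⟨y, m ≫ k, m ≫ l, r', by simpa using h₃, ?_, ?_⟩
    · simp [h₄, h₁]
    · simp [h₄, h₂]

/-- Locally, equality in the value at a presheaf of the colimit preserving extension of a locally
flat functor is witnessed by a span. -/
theorem LocallyFlat.locally_of_eq {L : (Aᵒᵖ ⥤ Type v) ⥤ Dᵒᵖ ⥤ Type v} [L.IsLeftAdjoint]
    (hL : LocallyFlat K (yoneda ⋙ L)) {P : Aᵒᵖ ⥤ Type v} {d : D} {a b : A}
    {p : P.obj (op a)} {s : (L.obj (yoneda.obj a)).obj (op d)}
    {q : P.obj (op b)} {t : (L.obj (yoneda.obj b)).obj (op d)}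
    (h : (L.map (yonedaEquiv.symm p)).app _ s = (L.map (yonedaEquiv.symm q)).app _ t) :
    Locally K fun e (f : e ⟶ d) =>
      ∃ (c : A) (g : c ⟶ a) (h : c ⟶ b) (r : (L.obj (yoneda.obj c)).obj (op e)),
        P.map g.op p = P.map h.op q ∧
          (L.map (yoneda.map g)).app _ r = (L.obj (yoneda.obj a)).map f.op s ∧
          (L.map (yoneda.map h)).app _ r = (L.obj (yoneda.obj b)).map f.op t := by
  refine rel_of_map_yonedaEquiv_symm_eq L (R := fun {a b} p s q t =>
    Locally K fun e (f : e ⟶ d) =>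
      ∃ (c : A) (g : c ⟶ a) (h : c ⟶ b) (r : (L.obj (yoneda.obj c)).obj (op e)),
        P.map g.op p = P.map h.op q ∧
          (L.map (yoneda.map g)).app _ r = (L.obj (yoneda.obj a)).map f.op s ∧
          (L.map (yoneda.map h)).app _ r = (L.obj (yoneda.obj b)).map f.op t) ?_ ?_ ?_ ?_ h
  · intro a p t
    exact .of_forall fun e f => ⟨a, 𝟙 a, 𝟙 a, (L.obj _).map f.op t, rfl, by simp, by simp⟩
  · intro a b g p t
    refine .of_forall fun e f => ⟨b, 𝟙 b, g, (L.obj _).map f.op t, by simp, by simp, ?_⟩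
    rw [NatTrans.naturality_apply]
  · intro a b p t q s h
    refine h.mono ?_
    rintro e f ⟨c, g, h, r, h₁, h₂, h₃⟩
    exact ⟨c, h, g, r, h₁.symm, h₃, h₂⟩
  · intro a b c p s q t p' s' h h'
    refine (h.and h').bind ?_
    rintro e f ⟨⟨x, g, h, r, h₁, h₂, h₃⟩, ⟨y, g', h', r', h₁', h₂', h₃'⟩⟩
    -- The two spans meet at the middle element, so completing this cospan composes them.
    refine (hL.exists_cospan h g' r r' (h₃.trans h₂'.symm)).mono ?_
    rintro e' f' ⟨z, k, l, r'', h₄, h₅, h₆⟩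
    refine ⟨z, k ≫ g, l ≫ h', r'', ?_, ?_, ?_⟩
    · simp only [op_comp, Functor.map_comp, comp_apply, h₁, ← h₁']
      simp only [← comp_apply, ← Functor.map_comp, ← op_comp, h₄]
    · have : (L.map (yoneda.map k)).app _ r'' = _ := h₅
      simp [this, NatTrans.naturality_apply, h₂]
    · have : (L.map (yoneda.map l)).app _ r'' = _ := h₆
      simp [this, NatTrans.naturality_apply, h₃']

end LocallyFlat

/-! ### The extension of a locally flat functor preserves finite limits -/

section LocallyFlat

variable {A : Type u} [Category.{v} A] {D : Type v} [SmallCategory D]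
  {K : GrothendieckTopology D}

theorem exists_of_isPullback_app {P Q R S : Aᵒᵖ ⥤ Type v} {fst : P ⟶ Q} {snd : P ⟶ R} {f : Q ⟶ S}
    {g : R ⟶ S} (h : IsPullback fst snd f g) {X : Aᵒᵖ} (q : Q.obj X) (r : R.obj X)
    (hqr : f.app X q = g.app X r) : ∃ p : P.obj X, fst.app X p = q ∧ snd.app X p = r :=
  Types.exists_of_isPullback (h.map ((evaluation _ _).obj X)) q r hqr

theorem ext_of_isPullback_app {P Q R S : Aᵒᵖ ⥤ Type v} {fst : P ⟶ Q} {snd : P ⟶ R} {f : Q ⟶ S}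
    {g : R ⟶ S} (h : IsPullback fst snd f g) {X : Aᵒᵖ} {p q : P.obj X}
    (h₁ : fst.app X p = fst.app X q) (h₂ : snd.app X p = snd.app X q) : p = q :=
  Types.ext_of_isPullback (h.map ((evaluation _ _).obj X)) h₁ h₂

theorem isTerminal_app_ext {P : Aᵒᵖ ⥤ Type v} (h : IsTerminal P) {X : Aᵒᵖ} (p q : P.obj X) :
    p = q := by
  have := Types.isTerminalEquivUnique _ (h.isTerminalObj ((evaluation _ (Type v)).obj X))
  exact (this.uniq p).trans (this.uniq q).symm

variable {L : (Aᵒᵖ ⥤ Type v) ⥤ Dᵒᵖ ⥤ Type v}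

theorem map_app_map_app {P Q R : Aᵒᵖ ⥤ Type v} (φ : P ⟶ Q) (ψ : Q ⟶ R) {d : Dᵒᵖ}
    (x : (L.obj P).obj d) :
    (L.map ψ).app d ((L.map φ).app d x) = (L.map (φ ≫ ψ)).app d x := by
  simp

theorem map_yoneda_app {P : Aᵒᵖ ⥤ Type v} {a b : A} (g : b ⟶ a) (p : P.obj (op a)) {d : Dᵒᵖ}
    (t : (L.obj (yoneda.obj b)).obj d) :
    (L.map (yonedaEquiv.symm p)).app d ((L.map (yoneda.map g)).app d t) =
      (L.map (yonedaEquiv.symm (P.map g.op p))).app d t := by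
  rw [map_app_map_app, map_yonedaEquiv_symm]

theorem map_symm_app {P Q : Aᵒᵖ ⥤ Type v} (φ : P ⟶ Q) {a : A} (p : P.obj (op a)) {d : Dᵒᵖ}
    (t : (L.obj (yoneda.obj a)).obj d) :
    (L.map φ).app d ((L.map (yonedaEquiv.symm p)).app d t) =
      (L.map (yonedaEquiv.symm (φ.app _ p))).app d t := by
  rw [map_app_map_app, yonedaEquiv_symm_comp]

variable [L.IsLeftAdjoint]

/-- Two elements with equal image over `R` are locally joined by a span, which supplies an element
of the presheaf pullback: this is local surjectivity. For local injectivity, the spans witnessing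
equality of the two projections are merged into one. -/
theorem LocallyFlat.W_pullbackComparison (hL : LocallyFlat K (yoneda ⋙ L))
    {P Q R : Aᵒᵖ ⥤ Type v} (f : P ⟶ R) (g : Q ⟶ R) : K.W (pullbackComparison L f g) := by
  have hA := IsPullback.of_hasPullback f g
  have hD := IsPullback.of_hasPullback (L.map f) (L.map g)
  have h₁ {d : Dᵒᵖ} (x) : (pullback.fst (L.map f) (L.map g)).app d
      ((pullbackComparison L f g).app d x) = (L.map (pullback.fst f g)).app d x := by
    rw [← comp_apply, ← NatTrans.comp_app, pullbackComparison_comp_fst]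
  have h₂ {d : Dᵒᵖ} (x) : (pullback.snd (L.map f) (L.map g)).app d
      ((pullbackComparison L f g).app d x) = (L.map (pullback.snd f g)).app d x := by
    rw [← comp_apply, ← NatTrans.comp_app, pullbackComparison_comp_snd]
  rw [K.W_iff_isLocallyBijective, isLocallyInjective_iff_locally, isLocallySurjective_iff_locally]
  constructor
  · intro d x y hxy
    obtain ⟨a, p, s, rfl⟩ := exists_map_yonedaEquiv_symm_eq L x
    obtain ⟨b, q, t, rfl⟩ := exists_map_yonedaEquiv_symm_eq L y
    have h₃ := congrArg ((pullback.fst (L.map f) (L.map g)).app _) hxy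
    have h₄ := congrArg ((pullback.snd (L.map f) (L.map g)).app _) hxy
    rw [h₁, h₁, map_symm_app, map_symm_app] at h₃
    rw [h₂, h₂, map_symm_app, map_symm_app] at h₄
    refine ((hL.locally_of_eq h₃).and (hL.locally_of_eq h₄)).bind ?_
    rintro e k ⟨⟨c, u, v, r, hp, hs, ht⟩, ⟨c', u', v', r', hp', hs', ht'⟩⟩
    -- Make the legs of the two spans towards `a` agree.
    refine (hL.exists_cospan u u' r r' (hs.trans hs'.symm)).bind ?_
    rintro e' k' ⟨x, m, m', r'', hm, hr, hr'⟩
    -- The legs towards `b` now agree on the local section, so a further refinement makes them equal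
    -- and one span serves both projections.
    refine (hL.exists_eq (m ≫ v) (m' ≫ v') r'' ?_).mono ?_
    · change (L.map _).app _ _ = (L.map _).app _ _
      change (L.map _).app _ _ = (L.obj _).map _ _ at hr hr'
      simp only [Functor.map_comp, NatTrans.comp_app, comp_apply, hr, hr',
        NatTrans.naturality_apply, ht, ht']
    · rintro e'' k'' ⟨y, n, r₃, hn, hr₃⟩
      change (L.map _).app _ _ = (L.obj _).map _ _ at hr hr' hr₃
      have e₁ : (L.obj (yoneda.obj a)).map ((k'' ≫ k') ≫ k).op s =
          (L.map (yoneda.map (n ≫ m ≫ u))).app _ r₃ := by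
        simp [hr₃, hr, hs, NatTrans.naturality_apply]
      have e₂ : (L.obj (yoneda.obj b)).map ((k'' ≫ k') ≫ k).op t =
          (L.map (yoneda.map (n ≫ m ≫ v))).app _ r₃ := by
        simp [hr₃, hr, ht, NatTrans.naturality_apply]
      rw [← NatTrans.naturality_apply, ← NatTrans.naturality_apply, e₁, e₂, map_yoneda_app,
        map_yoneda_app]
      suffices (pullback f g).map (n ≫ m ≫ u).op p = (pullback f g).map (n ≫ m ≫ v).op q by
        rw [this]
      apply ext_of_isPullback_app hA
      · rw [NatTrans.naturality_apply, NatTrans.naturality_apply]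
        simp [hp]
      · rw [NatTrans.naturality_apply, NatTrans.naturality_apply, hm, hn]
        simp [hp']
  · intro d x
    obtain ⟨a, p, s, hs⟩ := exists_map_yonedaEquiv_symm_eq L
      ((pullback.fst (L.map f) (L.map g)).app _ x)
    obtain ⟨b, q, t, ht⟩ := exists_map_yonedaEquiv_symm_eq L
      ((pullback.snd (L.map f) (L.map g)).app _ x)
    have h₃ := congrArg (fun k => k.app _ x) hD.w
    simp only [NatTrans.comp_app, comp_apply, ← hs, ← ht, map_symm_app] at h₃
    refine (hL.locally_of_eq h₃).mono ?_
    rintro e k ⟨c, u, v, r, h, hs', ht'⟩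
    rw [← NatTrans.naturality_apply, ← NatTrans.naturality_apply] at h
    obtain ⟨z, hz, hz'⟩ := exists_of_isPullback_app hA _ _ h
    refine ⟨(L.map (yonedaEquiv.symm z)).app _ r, ?_⟩
    apply ext_of_isPullback_app hD
    · rw [h₁, NatTrans.naturality_apply, ← hs, map_symm_app, hz, ← map_yoneda_app, hs',
        NatTrans.naturality_apply]
    · rw [h₂, NatTrans.naturality_apply, ← ht, map_symm_app, hz', ← map_yoneda_app, ht',
        NatTrans.naturality_apply]

theorem LocallyFlat.W_terminal (hL : LocallyFlat K (yoneda ⋙ L))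
    {P : Aᵒᵖ ⥤ Type v} {Q : Dᵒᵖ ⥤ Type v} (hP : IsTerminal P) (hQ : IsTerminal Q) :
    K.W (hQ.from (L.obj P)) := by
  rw [K.W_iff_isLocallyBijective, isLocallyInjective_iff_locally, isLocallySurjective_iff_locally]
  constructor
  · intro d x y _
    obtain ⟨a, p, s, rfl⟩ := exists_map_yonedaEquiv_symm_eq L x
    obtain ⟨b, q, t, rfl⟩ := exists_map_yonedaEquiv_symm_eq L y
    refine (hL.exists_span s t).mono ?_
    rintro e k ⟨c, g, h, r, hs, ht⟩
    change (L.map _).app _ _ = (L.obj _).map _ _ at hs ht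
    rw [← NatTrans.naturality_apply, ← NatTrans.naturality_apply, ← hs, ← ht, map_yoneda_app,
      map_yoneda_app, isTerminal_app_ext hP (P.map g.op p) (P.map h.op q)]
  · intro d x
    refine (hL.exists_obj d).mono ?_
    rintro e f ⟨a, ⟨t⟩⟩
    exact ⟨(L.map (hP.from _)).app _ t, isTerminal_app_ext hQ _ _⟩

/-- Terminal objects and pullbacks suffice. Sheafification preserves them and inverts the locally
bijective comparison maps. -/
theorem LocallyFlat.preservesFiniteLimits (hL : LocallyFlat K (yoneda ⋙ L)) :
    PreservesFiniteLimits (L ⋙ presheafToSheaf K (Type v)) := by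
  have : PreservesLimitsOfShape (Discrete PEmpty.{1}) (L ⋙ presheafToSheaf K (Type v)) := by
    have := (K.W_iff _).1 (hL.W_terminal terminalIsTerminal terminalIsTerminal)
    have : PreservesLimit (Functor.empty.{0} _) (L ⋙ presheafToSheaf K (Type v)) :=
      preservesTerminal_of_iso _ (asIso ((presheafToSheaf K (Type v)).map
        (terminalIsTerminal.from (L.obj (⊤_ _)))) ≪≫ PreservesTerminal.iso _)
    exact preservesLimitsOfShape_pempty_of_preservesTerminal _
  have : PreservesLimitsOfShape WalkingCospan (L ⋙ presheafToSheaf K (Type v)) := ⟨fun {F} => by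
    suffices ∀ {P Q R : Aᵒᵖ ⥤ Type v} (f : P ⟶ R) (g : Q ⟶ R),
        PreservesLimit (cospan f g) (L ⋙ presheafToSheaf K (Type v)) from
      preservesLimit_of_iso_diagram _ (diagramIsoCospan F).symm
    intro P Q R f g
    have := (K.W_iff _).1 (hL.W_pullbackComparison f g)
    have h : pullbackComparison (L ⋙ presheafToSheaf K (Type v)) f g =
        (presheafToSheaf K (Type v)).map (pullbackComparison L f g) ≫
          pullbackComparison (presheafToSheaf K (Type v)) (L.map f) (L.map g) := by
      apply pullback.hom_ext
      · exact (pullbackComparison_comp_fst _ f g).trans (by simp [← Functor.map_comp])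
      · exact (pullbackComparison_comp_snd _ f g).trans (by simp [← Functor.map_comp])
    have : IsIso (pullbackComparison (L ⋙ presheafToSheaf K (Type v)) f g) := by
      rw [h]
      infer_instance
    exact PreservesPullback.of_iso_comparison _⟩
  exact preservesFiniteLimits_of_preservesTerminal_and_pullbacks _

end LocallyFlat

/-! ### Left exact left adjoints from presheaves to sheaves -/

section LeftExact

variable {C : Type u} [Category.{v} C] {D : Type v} [SmallCategory D]
  {K : GrothendieckTopology D} (G : (Cᵒᵖ ⥤ Type v) ⥤ Sheaf K (Type v))

/-- The sections locally of this form are a subsheaf of `G.obj P` through which all maps coming from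
representables factor. Those maps are jointly epimorphic, so the inclusion is epi as well as mono,
hence an isomorphism. -/
theorem locally_exists_map_yonedaEquiv_symm [G.IsLeftAdjoint] {P : Cᵒᵖ ⥤ Type v} {d : D}
    (x : (G.obj P).obj.obj (op d)) :
    Locally K fun e (f : e ⟶ d) => ∃ (c : C) (p : P.obj (op c))
      (t : (G.obj (yoneda.obj c)).obj.obj (op e)),
        (G.map (yonedaEquiv.symm p)).hom.app _ t = (G.obj P).obj.map f.op x := by
  let N : Subfunctor (G.obj P).obj :=
    { obj d := {x | ∃ (c : C) (p : P.obj (op c)) (t : (G.obj (yoneda.obj c)).obj.obj d),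
        (G.map (yonedaEquiv.symm p)).hom.app _ t = x}
      map := by
        rintro d e f _ ⟨c, p, t, rfl⟩
        exact ⟨c, p, (G.obj _).obj.map f t, NatTrans.naturality_apply _ _ _⟩ }
  have hP : Presieve.IsSheaf K (G.obj P).obj := (isSheaf_iff_isSheaf_of_type _ _).1 (G.obj P).property
  let N' : Sheaf K (Type v) := ⟨(N.sheafify K).toFunctor,
    (isSheaf_iff_isSheaf_of_type _ _).2 (N.sheafify_isSheaf hP)⟩
  let ι : N' ⟶ G.obj P := ⟨(N.sheafify K).ι⟩
  have : Mono ι := (sheafToPresheaf K (Type v)).mono_of_mono_map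
    (inferInstanceAs (Mono (N.sheafify K).ι))
  have hι (c : C) (p : P.obj (op c)) : ∃ k, k ≫ ι = G.map (yonedaEquiv.symm p) := by
    have h : Subfunctor.range (G.map (yonedaEquiv.symm p)).hom ≤ N.sheafify K := by
      rintro d _ ⟨t, rfl⟩
      exact N.le_sheafify K _ ⟨c, p, t, rfl⟩
    refine ⟨⟨Subfunctor.lift _ h⟩, ?_⟩
    ext : 1
    exact Subfunctor.lift_ι _ h
  have : Epi ι := ⟨fun a b hab => hom_ext_of_isLeftAdjoint fun c p => by
    obtain ⟨k, hk⟩ := hι c p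
    rw [← hk, Category.assoc, hab, Category.assoc]⟩
  have : IsIso ι := isIso_of_mono_of_epi ι
  let x' : N'.obj.obj (op d) := (inv ι).hom.app _ x
  have hx' : x'.1 = x := by
    have := congrArg (fun k => k.hom.app (op d) x) (IsIso.inv_hom_id ι)
    exact this
  exact ⟨N.sieveOfSection x, hx' ▸ x'.2, fun e f hf => hf⟩

/-- The functor of sections at `d` is left exact on a category with finite limits, so its category
of elements has finite limits. -/
theorem isCofiltered_elements [PreservesFiniteLimits G] (d : Dᵒᵖ) :
    IsCofiltered (G ⋙ sheafToPresheaf K (Type v) ⋙ (evaluation _ _).obj d).Elements := by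
  have : PreservesFiniteLimits (sheafToPresheaf K (Type v)) := ⟨fun _ _ _ => inferInstance⟩
  have : PreservesFiniteLimits ((evaluation Dᵒᵖ (Type v)).obj d) := ⟨fun _ _ _ => inferInstance⟩
  have := comp_preservesFiniteLimits (sheafToPresheaf K (Type v)) ((evaluation Dᵒᵖ (Type v)).obj d)
  have := comp_preservesFiniteLimits G (sheafToPresheaf K (Type v) ⋙ (evaluation Dᵒᵖ (Type v)).obj d)
  have : HasFiniteLimits
      (G ⋙ sheafToPresheaf K (Type v) ⋙ (evaluation _ _).obj d).Elements :=
    ⟨fun J _ _ => inferInstance⟩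
  exact IsCofiltered.of_hasFiniteLimits _

variable [PreservesFiniteLimits G]

theorem exists_section (d : Dᵒᵖ) : ∃ P : Cᵒᵖ ⥤ Type v, Nonempty ((G.obj P).obj.obj d) := by
  have := isCofiltered_elements G d
  obtain ⟨⟨P, x⟩⟩ := IsCofiltered.nonempty
    (C := (G ⋙ sheafToPresheaf K (Type v) ⋙ (evaluation _ _).obj d).Elements)
  exact ⟨P, ⟨x⟩⟩

theorem exists_section_span {d : Dᵒᵖ} {P Q : Cᵒᵖ ⥤ Type v} (x : (G.obj P).obj.obj d)
    (y : (G.obj Q).obj.obj d) :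
    ∃ (R : Cᵒᵖ ⥤ Type v) (φ : R ⟶ P) (ψ : R ⟶ Q) (z : (G.obj R).obj.obj d),
      (G.map φ).hom.app d z = x ∧ (G.map ψ).hom.app d z = y := by
  have := isCofiltered_elements G d
  obtain ⟨⟨R, z⟩, φ, ψ, -⟩ := IsCofilteredOrEmpty.cone_objs
    (C := (G ⋙ sheafToPresheaf K (Type v) ⋙ (evaluation _ _).obj d).Elements) ⟨P, x⟩ ⟨Q, y⟩
  exact ⟨R, φ.1, ψ.1, z, φ.2, ψ.2⟩

theorem exists_section_eq {d : Dᵒᵖ} {P Q : Cᵒᵖ ⥤ Type v} (α β : P ⟶ Q) (x : (G.obj P).obj.obj d)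
    (h : (G.map α).hom.app d x = (G.map β).hom.app d x) :
    ∃ (R : Cᵒᵖ ⥤ Type v) (φ : R ⟶ P) (z : (G.obj R).obj.obj d),
      φ ≫ α = φ ≫ β ∧ (G.map φ).hom.app d z = x := by
  have := isCofiltered_elements G d
  let X : (G ⋙ sheafToPresheaf K (Type v) ⋙ (evaluation _ _).obj d).Elements := ⟨P, x⟩
  let Y : (G ⋙ sheafToPresheaf K (Type v) ⋙ (evaluation _ _).obj d).Elements :=
    ⟨Q, (G.map α).hom.app d x⟩
  let a : X ⟶ Y := ⟨α, rfl⟩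
  let b : X ⟶ Y := ⟨β, h.symm⟩
  obtain ⟨⟨R, z⟩, φ, hφ⟩ := IsCofilteredOrEmpty.cone_maps a b
  exact ⟨R, φ.1, z, congrArg Subtype.val hφ, φ.2⟩

theorem exists_section_cospan {d : Dᵒᵖ} {P Q S : Cᵒᵖ ⥤ Type v} (α : P ⟶ S) (β : Q ⟶ S)
    (x : (G.obj P).obj.obj d) (y : (G.obj Q).obj.obj d)
    (h : (G.map α).hom.app d x = (G.map β).hom.app d y) :
    ∃ (R : Cᵒᵖ ⥤ Type v) (φ : R ⟶ P) (ψ : R ⟶ Q) (z : (G.obj R).obj.obj d),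
      φ ≫ α = ψ ≫ β ∧ (G.map φ).hom.app d z = x ∧ (G.map ψ).hom.app d z = y := by
  obtain ⟨R, φ, ψ, z, rfl, rfl⟩ := exists_section_span G x y
  obtain ⟨R', θ, z', h', rfl⟩ := exists_section_eq G (φ ≫ α) (ψ ≫ β) z (by simpa using h)
  exact ⟨R', θ ≫ φ, θ ≫ ψ, z', by simpa using h', by simp, by simp⟩

theorem yonedaEquiv_symm_eq_map {a c : C} (g : c ⟶ a) :
    (yonedaEquiv (F := yoneda.obj a)).symm g = yoneda.map g :=
  yonedaEquiv.injective (by rw [Equiv.apply_symm_apply, yonedaEquiv_yoneda_map])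

/-- Left exactness yields spans and equalizing maps whose apex is an arbitrary presheaf; locally,
the section over that apex comes from a representable. -/
theorem locallyFlat_of_preservesFiniteLimits [G.IsLeftAdjoint] :
    LocallyFlat K (yoneda ⋙ G ⋙ sheafToPresheaf K (Type v)) where
  exists_obj d := by
    obtain ⟨P, ⟨x⟩⟩ := exists_section G (op d)
    refine (locally_exists_map_yonedaEquiv_symm G x).mono ?_
    rintro e f ⟨c, p, t, -⟩
    exact ⟨c, ⟨t⟩⟩
  exists_span {d a b} s t := by
    obtain ⟨P, φ, ψ, x, rfl, rfl⟩ := exists_section_span G s t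
    refine (locally_exists_map_yonedaEquiv_symm G x).mono ?_
    rintro e f ⟨c, p, t, h⟩
    -- The maps `φ` and `ψ` into representables send the element `p` at `c` to morphisms out of `c`.
    refine ⟨c, φ.app _ p, ψ.app _ p, t, ?_, ?_⟩
    · change (G.map (yoneda.map _)).hom.app _ _ = (G.obj _).obj.map _ _
      rw [← NatTrans.naturality_apply, ← h, ← yonedaEquiv_symm_eq_map, ← yonedaEquiv_symm_comp]
      simp
    · change (G.map (yoneda.map _)).hom.app _ _ = (G.obj _).obj.map _ _
      rw [← NatTrans.naturality_apply, ← h, ← yonedaEquiv_symm_eq_map, ← yonedaEquiv_symm_comp]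
      simp
  exists_eq {d a b} g h t ht := by
    obtain ⟨P, φ, x, hφ, rfl⟩ := exists_section_eq G (yoneda.map g) (yoneda.map h) t ht
    refine (locally_exists_map_yonedaEquiv_symm G x).mono ?_
    rintro e f ⟨c, p, t, h'⟩
    refine ⟨c, φ.app _ p, t, ?_, ?_⟩
    · exact ConcreteCategory.congr_hom (NatTrans.congr_app hφ (op c)) p
    · change (G.map (yoneda.map _)).hom.app _ _ = (G.obj _).obj.map _ _
      rw [← NatTrans.naturality_apply, ← h', ← yonedaEquiv_symm_eq_map, ← yonedaEquiv_symm_comp]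
      simp

end LeftExact

/-! ### Products of locally flat functors -/

/-- Coordinates are chosen independently, with the extra condition `T` imposed only at `i`. -/
theorem exists_pi_of_exists {ι : Type*} {α : ι → Type*} {Q : ∀ j, α j → Prop} (i : ι)
    {T : α i → Prop} (hi : ∃ x, T x ∧ Q i x) (h : ∀ j, ∃ x, Q j x) :
    ∃ z : ∀ j, α j, T (z i) ∧ ∀ j, Q j (z j) := by
  classical
  obtain ⟨x, hT, hQ⟩ := hi
  choose y hy using h
  refine ⟨Function.update y i x, by simpa using hT, fun j => ?_⟩
  by_cases hj : j = i
  · subst hj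
    simpa using hQ
  · simpa [hj] using hy j

section Product

variable {n : ℕ} {C : Fin n → Type u} [∀ i, Category.{v} (C i)] {D : Type v} [SmallCategory D]
  {K : GrothendieckTopology D}

/-- The external product of functors with values in presheaves. -/
@[simps]
def piFunctor (F : ∀ i, C i ⥤ Dᵒᵖ ⥤ Type v) : (∀ i, C i) ⥤ Dᵒᵖ ⥤ Type v where
  obj X :=
    { obj d := ∀ i, ((F i).obj (X i)).obj d
      map f := ↾fun x i => ((F i).obj (X i)).map f (x i) }
  map g := { app d := ↾fun x i => ((F i).map (g i)).app d (x i) }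

/-- The projections of the external product. -/
@[simps]
def piFunctorProj (F : ∀ i, C i ⥤ Dᵒᵖ ⥤ Type v) (X : ∀ i, C i) (i : Fin n) :
    (piFunctor F).obj X ⟶ (F i).obj (X i) where
  app d := ↾fun x => x i

theorem locallyFlat_piFunctor {F : ∀ i, C i ⥤ Dᵒᵖ ⥤ Type v} (hF : ∀ i, LocallyFlat K (F i)) :
    LocallyFlat K (piFunctor F) where
  exists_obj d := by
    refine (Locally.forall fun i => (hF i).exists_obj d).mono ?_
    intro e f h
    choose X hX using h
    exact ⟨X, ⟨fun i => (hX i).some⟩⟩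
  exists_span s t := by
    refine (Locally.forall fun i => (hF i).exists_span (s i) (t i)).mono ?_
    intro e f h
    choose c g h r hg hh using h
    exact ⟨c, g, h, r, funext hg, funext hh⟩
  exists_eq g h t ht := by
    refine (Locally.forall fun i => (hF i).exists_eq (g i) (h i) (t i) (congrFun ht i)).mono ?_
    intro e f h
    choose c k r hk hr using h
    exact ⟨c, k, r, funext hk, funext hr⟩

end Product

/-! ### Passing from functors on presheaves to morphisms of toposes -/

section

variable {A : Type u} [Category.{v} A] {E : Type w} [Category.{w'} E]

/-- By transposition, extending maps from `S` to the representable becomes extending along `L.map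
S.functorInclusion`, which is uniquely possible for an isomorphism. -/
theorem isSheafFor_rightAdjoint {L : (Aᵒᵖ ⥤ Type v) ⥤ E} {R : E ⥤ Aᵒᵖ ⥤ Type v} (adj : L ⊣ R)
    {X : A} (S : Sieve X) [IsIso (L.map S.functorInclusion)] (M : E) :
    Presieve.IsSheafFor (R.obj M) S.arrows := by
  rw [Presieve.isSheafFor_iff_yonedaSheafCondition]
  intro f
  refine ⟨adj.homEquiv _ _ (inv (L.map S.functorInclusion) ≫ (adj.homEquiv _ _).symm f), ?_, ?_⟩
  · dsimp only
    rw [← adj.homEquiv_naturality_left]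
    simp
  · intro g hg
    rw [← Equiv.symm_apply_eq, IsIso.eq_inv_comp, ← adj.homEquiv_naturality_left_symm, hg]

/-- The morphism of toposes defined by a left exact left adjoint functor on presheaves whose right
adjoint takes values in sheaves. -/
noncomputable def geomMorphOfPresheaf {L : (Aᵒᵖ ⥤ Type v) ⥤ E} {R : E ⥤ Aᵒᵖ ⥤ Type v} (adj : L ⊣ R)
    [PreservesFiniteLimits L] (J : GrothendieckTopology A)
    (hR : ∀ M, Presheaf.IsSheaf J (R.obj M)) : GeomMorph E (Sheaf J (Type v)) where
  inverseImage := sheafToPresheaf J (Type v) ⋙ L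
  directImage := ObjectProperty.lift _ R hR
  adj := adj.restrictFullyFaithful (fullyFaithfulSheafToPresheaf J (Type v))
    (Functor.FullyFaithful.id _) (Iso.refl _) (Iso.refl _)
  preservesFiniteLimits := by
    have : PreservesFiniteLimits (sheafToPresheaf J (Type v)) := ⟨fun _ _ _ => inferInstance⟩
    exact comp_preservesFiniteLimits _ _

/-- A left adjoint functor on presheaves whose right adjoint takes values in sheaves
factors through sheafification. -/
noncomputable def presheafToSheafCompIso {L : (Aᵒᵖ ⥤ Type v) ⥤ E} {R : E ⥤ Aᵒᵖ ⥤ Type v}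
    (adj : L ⊣ R) [PreservesFiniteLimits L] (J : GrothendieckTopology A) [HasSheafify J (Type v)]
    (hR : ∀ M, Presheaf.IsSheaf J (R.obj M)) :
    presheafToSheaf J (Type v) ⋙ sheafToPresheaf J (Type v) ⋙ L ≅ L :=
  ((sheafificationAdjunction J (Type v)).comp
    (geomMorphOfPresheaf adj J hR).adj).leftAdjointUniq adj

end

/-! ### The extension inverts covering sieves of the join -/

section Extension

variable {n : ℕ} {C : Fin n → Type u} [∀ i, Category.{v} (C i)] {D : Type v} [SmallCategory D]
  {K : GrothendieckTopology D} (J : ∀ i, GrothendieckTopology (C i))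
  (G : ∀ i, ((C i)ᵒᵖ ⥤ Type v) ⥤ Sheaf K (Type v)) [∀ i, (G i).IsLeftAdjoint]
  {L : ((∀ i, C i)ᵒᵖ ⥤ Type v) ⥤ Dᵒᵖ ⥤ Type v}

theorem locally_exists_of_isIso_map {C : Type u} [Category.{v} C]
    (G : (Cᵒᵖ ⥤ Type v) ⥤ Sheaf K (Type v)) [G.IsLeftAdjoint] {X : C} (S : Sieve X)
    [IsIso (G.map S.functorInclusion)] {d : D} (x : (G.obj (yoneda.obj X)).obj.obj (op d)) :
    Locally K fun e (f : e ⟶ d) => ∃ (c : C) (g : c ⟶ X)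
      (t : (G.obj (yoneda.obj c)).obj.obj (op e)),
      S g ∧ (G.map (yoneda.map g)).hom.app _ t = (G.obj (yoneda.obj X)).obj.map f.op x := by
  refine (locally_exists_map_yonedaEquiv_symm G
    ((inv (G.map S.functorInclusion)).hom.app _ x)).mono ?_
  rintro e f ⟨c, p, t, h⟩
  refine ⟨c, S.functorInclusion.app _ p, t, p.2, ?_⟩
  have h' := congrArg ((G.map S.functorInclusion).hom.app _) h
  have h₁ : (G.map S.functorInclusion).hom.app _ ((inv (G.map S.functorInclusion)).hom.app _ x) =
      x := congrArg (fun k => k.hom.app (op d) x) (IsIso.inv_hom_id (G.map S.functorInclusion))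
  rw [NatTrans.naturality_apply, h₁] at h'
  rw [← h', ← yonedaEquiv_symm_eq_map]
  change _ = ((G.map _) ≫ (G.map _)).hom.app _ t
  rw [← G.map_comp, yonedaEquiv_symm_comp]

/-- Only the `i`-th coordinate has to be lifted through the slice sieve; identities can serve
elsewhere, since membership in `S` follows from the `i`-th component alone. -/
theorem isLocallySurjective_map_functorInclusion
    (θ : piFunctor (fun i => yoneda ⋙ G i ⋙ sheafToPresheaf K (Type v)) ≅ yoneda ⋙ L)
    {X : ∀ i, C i} {S : Sieve X} {i : Fin n}
    [IsIso ((G i).map (sliceSieve S i).functorInclusion)] :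
    Presheaf.IsLocallySurjective K (L.map S.functorInclusion) := by
  rw [isLocallySurjective_iff_locally]
  intro d x
  refine (locally_exists_of_isIso_map (G i) (sliceSieve S i) ((θ.inv.app X).app _ x i)).mono ?_
  rintro e f ⟨c, g, t, hg, ht⟩
  obtain ⟨z, hz, hz'⟩ := exists_pi_of_exists
    (α := fun j => (c : C j) × (c ⟶ X j) × ((G j).obj (yoneda.obj c)).obj.obj (op e))
    (Q := fun j z => ((G j).map (yoneda.map z.2.1)).hom.app _ z.2.2 =
      ((G j).obj (yoneda.obj (X j))).obj.map f.op ((θ.inv.app X).app _ x j)) i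
    (T := fun z => sliceSieve S i z.2.1) ⟨⟨c, g, t⟩, hg, ht⟩
    (fun j => ⟨⟨X j, 𝟙 _, _⟩, by simp; rfl⟩)
  let Z : ∀ i, C i := fun j => (z j).1
  let h : Z ⟶ X := fun j => (z j).2.1
  have hS : S h := mem_of_sliceSieve (f := h i) hz (𝟙 _) (by simp)
  let t' : (L.obj (yoneda.obj Z)).obj (op e) := (θ.hom.app Z).app _ (fun j => (z j).2.2)
  refine ⟨(L.map (S.toFunctor h hS)).app _ t', ?_⟩
  have hh : S.toFunctor h hS ≫ S.functorInclusion = yoneda.map h := rfl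
  rw [map_app_map_app, hh]
  have h₁ := app_map_app θ.hom h (d := op e) (fun j => (z j).2.2)
  refine h₁.symm.trans ?_
  have h₂ : ((piFunctor (fun i => yoneda ⋙ G i ⋙ sheafToPresheaf K (Type v))).map h).app (op e)
      (fun j => (z j).2.2) = ((piFunctor _).obj X).map f.op ((θ.inv.app X).app _ x) := funext hz'
  rw [h₂, NatTrans.naturality_apply, hom_inv_app_app]
  rfl

theorem locallyFlat_extension
    (θ : piFunctor (fun i => yoneda ⋙ G i ⋙ sheafToPresheaf K (Type v)) ≅ yoneda ⋙ L)
    [∀ i, PreservesFiniteLimits (G i)] : LocallyFlat K (yoneda ⋙ L) :=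
  (locallyFlat_piFunctor fun i => locallyFlat_of_preservesFiniteLimits (G i)).of_iso θ

/-- Left exactness makes the image of the inclusion mono, local surjectivity makes it epi, and
sheaves form a balanced category. -/
theorem isIso_map_functorInclusion [L.IsLeftAdjoint]
    (θ : piFunctor (fun i => yoneda ⋙ G i ⋙ sheafToPresheaf K (Type v)) ≅ yoneda ⋙ L)
    [∀ i, PreservesFiniteLimits (G i)] {X : ∀ i, C i} {S : Sieve X}
    {i : Fin n} [IsIso ((G i).map (sliceSieve S i).functorInclusion)] :
    IsIso ((L ⋙ presheafToSheaf K (Type v)).map S.functorInclusion) := by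
  have := (locallyFlat_extension G θ).preservesFiniteLimits
  have : Mono ((L ⋙ presheafToSheaf K (Type v)).map S.functorInclusion) := inferInstance
  have : Sheaf.IsLocallySurjective ((L ⋙ presheafToSheaf K (Type v)).map S.functorInclusion) :=
    (Presheaf.isLocallySurjective_presheafToSheaf_map_iff K _).2
      (isLocallySurjective_map_functorInclusion G θ (i := i))
  exact isIso_of_mono_of_epi _

theorem isSheaf_joinTopology [L.IsLeftAdjoint]
    (θ : piFunctor (fun i => yoneda ⋙ G i ⋙ sheafToPresheaf K (Type v)) ≅ yoneda ⋙ L)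
    [∀ i, PreservesFiniteLimits (G i)]
    (hG : ∀ i (X : C i) (S : Sieve X), S ∈ J i X → IsIso ((G i).map S.functorInclusion))
    {E : Type w} [Category.{w'} E] (H : Sheaf K (Type v) ⥤ E) {R : E ⥤ (∀ i, C i)ᵒᵖ ⥤ Type v}
    (adj : (L ⋙ presheafToSheaf K (Type v)) ⋙ H ⊣ R) (M : E) :
    Presheaf.IsSheaf (joinTopology J) (R.obj M) := by
  rw [isSheaf_iff_isSheaf_of_type]
  refine Presieve.isSheaf_of_le _ (J₂ := Sheaf.finestTopology {R.obj M}) ?_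
    (Sheaf.sheaf_for_finestTopology _ rfl)
  -- By minimality of the join, the sheaf condition need only be tested on each induced topology.
  refine sInf_le fun i => Sheaf.le_finestTopology _ _ ?_
  rintro _ rfl X S hS
  have := hG _ _ _ ((exists_presieve_iff J i S).1 hS)
  have := isIso_map_functorInclusion G θ (S := S) (i := i)
  have : IsIso (((L ⋙ presheafToSheaf K (Type v)) ⋙ H).map S.functorInclusion) :=
    inferInstanceAs (IsIso (H.map _))
  exact isSheafFor_rightAdjoint adj S M

end Extension

/-! ### Restricting the extension along the projections -/

section Comparison

variable {n : ℕ} {C : Fin n → Type u} [∀ i, Category.{v} (C i)] {D : Type v} [SmallCategory D]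
  {K : GrothendieckTopology D}
  (G : ∀ i, ((C i)ᵒᵖ ⥤ Type v) ⥤ Sheaf K (Type v))
  {L : ((∀ i, C i)ᵒᵖ ⥤ Type v) ⥤ Dᵒᵖ ⥤ Type v}

variable (C) in
/-- Composition of presheaves with the `i`-th projection. -/
abbrev pullbackEval (i : Fin n) : ((C i)ᵒᵖ ⥤ Type v) ⥤ (∀ i, C i)ᵒᵖ ⥤ Type v :=
  (Functor.whiskeringLeft _ _ (Type v)).obj (Pi.eval C i).op

/-- The map keeps the `i`-th coordinate of a tuple of sections and applies `G i` to `p`. The formula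
determines it on all elements. -/
theorem exists_comparison [L.IsLeftAdjoint]
    (θ : piFunctor (fun i => yoneda ⋙ G i ⋙ sheafToPresheaf K (Type v)) ≅ yoneda ⋙ L)
    (i : Fin n) :
    ∃ φ : pullbackEval C i ⋙ L ⟶ G i ⋙ sheafToPresheaf K (Type v),
      ∀ (P : (C i)ᵒᵖ ⥤ Type v) (X : ∀ i, C i) (p : P.obj (op (X i))) (d : Dᵒᵖ)
        (s : ∀ i, ((G i).obj (yoneda.obj (X i))).obj.obj d),
        (φ.app P).app d ((L.map ((yonedaEquiv (F := (pullbackEval C i).obj P)).symm p)).app d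
          ((θ.hom.app X).app d s)) = ((G i).map (yonedaEquiv.symm p)).hom.app d (s i) := by
  have h (P : (C i)ᵒᵖ ⥤ Type v) := exists_desc_of_isLeftAdjoint L
    (P := (pullbackEval C i).obj P) (M := ((G i).obj P).obj)
    (fun X p => θ.inv.app X ≫ piFunctorProj _ X i ≫
      ((G i).map ((yonedaEquiv (X := X i) (F := P)).symm p)).hom) (by
      intro X Z g p
      ext d t
      change ((G i).map ((yonedaEquiv (F := P)).symm p)).hom.app d ((θ.inv.app X).app d
        ((L.map (yoneda.map g)).app d t) i) =
        ((G i).map ((yonedaEquiv (F := P)).symm (P.map (g i).op p))).hom.app d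
          ((θ.inv.app Z).app d t i)
      have hm : (G i).map ((yonedaEquiv (F := P)).symm (P.map (g i).op p)) =
          (G i).map (yoneda.map (g i)) ≫ (G i).map ((yonedaEquiv (F := P)).symm p) := by
        rw [← Functor.map_comp]
        exact congrArg _ (map_yonedaEquiv_symm (P := P) (g i) p).symm
      rw [hm]
      have := congrFun (app_map_app θ.inv g t) i
      exact congrArg (((G i).map ((yonedaEquiv (F := P)).symm p)).hom.app d) this)
  choose l hl using h
  have hl' (P : (C i)ᵒᵖ ⥤ Type v) (X : ∀ i, C i) (p : P.obj (op (X i))) (d : Dᵒᵖ)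
        (s : ∀ i, ((G i).obj (yoneda.obj (X i))).obj.obj d) :
        (l P).app d ((L.map ((yonedaEquiv (F := (pullbackEval C i).obj P)).symm p)).app d
          ((θ.hom.app X).app d s)) = ((G i).map (yonedaEquiv.symm p)).hom.app d (s i) := by
    have := ConcreteCategory.congr_hom (NatTrans.congr_app (hl P X p) d) ((θ.hom.app X).app d s)
    refine this.trans ?_
    have h₁ : (θ.inv.app X).app d ((θ.hom.app X).app d s) = s := inv_hom_app_app θ _
    exact congrArg (fun s => ((G i).map ((yonedaEquiv (F := P)).symm p)).hom.app d (s i)) h₁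
  refine ⟨{ app := l, naturality := fun P Q ψ => ?_ }, hl'⟩
  refine hom_ext_of_isLeftAdjoint (L := L) (P := (pullbackEval C i).obj P) ?_
  intro X p
  ext d t
  obtain ⟨s, rfl⟩ : ∃ s, (θ.hom.app X).app d s = t := ⟨_, hom_inv_app_app θ t⟩
  change (l Q).app d ((L.map ((pullbackEval C i).map ψ)).app d ((L.map (yonedaEquiv.symm p)).app d
      ((θ.hom.app X).app d s))) = ((G i).map ψ).hom.app d ((l P).app d
        ((L.map (yonedaEquiv.symm p)).app d ((θ.hom.app X).app d s)))
  rw [map_symm_app]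
  refine (hl' Q X (ψ.app _ p) d s).trans ?_
  refine Eq.trans ?_ (congrArg (((G i).map ψ).hom.app d) (hl' P X p d s)).symm
  have hm : (G i).map ((yonedaEquiv (F := Q)).symm (ψ.app (op (X i)) p)) =
      (G i).map ((yonedaEquiv (F := P)).symm p) ≫ (G i).map ψ := by
    rw [← Functor.map_comp]
    exact congrArg _ (yonedaEquiv_symm_comp (X := X i) ψ p).symm
  rw [hm]
  rfl

variable [∀ i, (G i).IsLeftAdjoint] [∀ i, PreservesFiniteLimits (G i)]

/-- The `i`-th coordinate carries all the information about `P`. Local flatness of the other `G j`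
fills the remaining coordinates: by spans for injectivity, by local existence of sections for
surjectivity. -/
theorem W_comparison [L.IsLeftAdjoint]
    (θ : piFunctor (fun i => yoneda ⋙ G i ⋙ sheafToPresheaf K (Type v)) ≅ yoneda ⋙ L)
    {i : Fin n} {P : (C i)ᵒᵖ ⥤ Type v} (φ : L.obj ((pullbackEval C i).obj P) ⟶ ((G i).obj P).obj)
    (hφ : ∀ (X : ∀ i, C i) (p : P.obj (op (X i))) (d : Dᵒᵖ)
        (s : ∀ i, ((G i).obj (yoneda.obj (X i))).obj.obj d),
        φ.app d ((L.map ((yonedaEquiv (F := (pullbackEval C i).obj P)).symm p)).app d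
          ((θ.hom.app X).app d s)) = ((G i).map (yonedaEquiv.symm p)).hom.app d (s i)) :
    K.W φ := by
  rw [K.W_iff_isLocallyBijective, isLocallyInjective_iff_locally, isLocallySurjective_iff_locally]
  constructor
  · intro d x y hxy
    obtain ⟨X, p, s', rfl⟩ := exists_map_yonedaEquiv_symm_eq L x
    obtain ⟨Y, q, t', rfl⟩ := exists_map_yonedaEquiv_symm_eq L y
    obtain ⟨s, rfl⟩ : ∃ s, (θ.hom.app X).app _ s = s' := ⟨_, hom_inv_app_app θ s'⟩
    obtain ⟨t, rfl⟩ : ∃ t, (θ.hom.app Y).app _ t = t' := ⟨_, hom_inv_app_app θ t'⟩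
    have h := (hφ X p _ s).symm.trans (hxy.trans (hφ Y q _ t))
    -- Left exactness of `G i` lifts the equality to a section over a presheaf `R` on which `p` and
    -- `q` agree; it is covered by representables afterwards.
    obtain ⟨R, α, β, z, hαβ, hα, hβ⟩ := exists_section_cospan (G i) _ _ _ _ h
    refine ((Locally.forall fun j =>
      (locallyFlat_of_preservesFiniteLimits (G j)).exists_span (s j) (t j)).and
        (locally_exists_map_yonedaEquiv_symm (G i) z)).mono ?_
    rintro e f ⟨h₁, ⟨c, ρ, r, hr⟩⟩
    obtain ⟨z, hz, hz'⟩ := exists_pi_of_exists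
      (α := fun j => (c : C j) × (c ⟶ X j) × (c ⟶ Y j) × ((G j).obj (yoneda.obj c)).obj.obj (op e))
      (Q := fun j z => ((G j).map (yoneda.map z.2.1)).hom.app _ z.2.2.2 =
        ((G j).obj (yoneda.obj (X j))).obj.map f.op (s j) ∧
        ((G j).map (yoneda.map z.2.2.1)).hom.app _ z.2.2.2 =
        ((G j).obj (yoneda.obj (Y j))).obj.map f.op (t j)) i
      (T := fun z => P.map z.2.1.op p = P.map z.2.2.1.op q)
      (by
        refine ⟨⟨c, α.app _ ρ, β.app _ ρ, r⟩, ?_, ?_, ?_⟩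
        · have := ConcreteCategory.congr_hom (NatTrans.congr_app hαβ (op c)) ρ
          exact this
        · dsimp only
          rw [← yonedaEquiv_symm_eq_map, ← yonedaEquiv_symm_comp, ← hα,
            ← NatTrans.naturality_apply, ← hr, (G i).map_comp]
          rfl
        · dsimp only
          rw [← yonedaEquiv_symm_eq_map, ← yonedaEquiv_symm_comp, ← hβ,
            ← NatTrans.naturality_apply, ← hr, (G i).map_comp]
          rfl)
      (fun j => by
        obtain ⟨c, g, h, r, hg, hh⟩ := h₁ j
        exact ⟨⟨c, g, h, r⟩, hg, hh⟩)
    let Z : ∀ i, C i := fun j => (z j).1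
    let g : Z ⟶ X := fun j => (z j).2.1
    let h : Z ⟶ Y := fun j => (z j).2.2.1
    let r' : (L.obj (yoneda.obj Z)).obj (op e) := (θ.hom.app Z).app _ (fun j => (z j).2.2.2)
    have hg : (L.map (yoneda.map g)).app _ r' =
        (L.obj (yoneda.obj X)).map f.op ((θ.hom.app X).app _ s) := by
      refine (app_map_app θ.hom g (d := op e) (fun j => (z j).2.2.2)).symm.trans ?_
      refine Eq.trans ?_ (NatTrans.naturality_apply (θ.hom.app X) f.op s)
      exact congrArg ((θ.hom.app X).app _) (funext fun j => (hz' j).1)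
    have hh : (L.map (yoneda.map h)).app _ r' =
        (L.obj (yoneda.obj Y)).map f.op ((θ.hom.app Y).app _ t) := by
      refine (app_map_app θ.hom h (d := op e) (fun j => (z j).2.2.2)).symm.trans ?_
      refine Eq.trans ?_ (NatTrans.naturality_apply (θ.hom.app Y) f.op t)
      exact congrArg ((θ.hom.app Y).app _) (funext fun j => (hz' j).2)
    refine (NatTrans.naturality_apply (L.map (yonedaEquiv.symm p)) f.op _).symm.trans
      (Eq.trans ?_ (NatTrans.naturality_apply (L.map (yonedaEquiv.symm q)) f.op _))
    rw [← hg, ← hh, map_yoneda_app, map_yoneda_app]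
    have hz₁ : ((pullbackEval C i).obj P).map g.op p = ((pullbackEval C i).obj P).map h.op q := hz
    rw [hz₁]
  · intro d x
    refine ((Locally.forall fun j =>
      (locallyFlat_of_preservesFiniteLimits (G j)).exists_obj d).and
        (locally_exists_map_yonedaEquiv_symm (G i) x)).mono ?_
    rintro e f ⟨h₁, ⟨c, p, r, hr⟩⟩
    obtain ⟨z, ⟨p, hz⟩, -⟩ := exists_pi_of_exists
      (α := fun j => (c : C j) × ((G j).obj (yoneda.obj c)).obj.obj (op e))
      (Q := fun j z => True) i
      (T := fun z => ∃ p : P.obj (op z.1), ((G i).map (yonedaEquiv.symm p)).hom.app _ z.2 =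
        ((G i).obj P).obj.map f.op x) ⟨⟨c, r⟩, ⟨p, hr⟩, trivial⟩
      (fun j => by
        obtain ⟨c, ⟨r⟩⟩ := h₁ j
        exact ⟨⟨c, r⟩, trivial⟩)
    exact ⟨_, (hφ (fun j => (z j).1) p _ (fun j => (z j).2)).trans hz⟩

/-- Sheafifying inverts the comparison map, and `G i` already takes values in sheaves. -/
theorem nonempty_pullbackEval_comp_iso [L.IsLeftAdjoint]
    (θ : piFunctor (fun i => yoneda ⋙ G i ⋙ sheafToPresheaf K (Type v)) ≅ yoneda ⋙ L)
    (i : Fin n) :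
    Nonempty (pullbackEval C i ⋙ L ⋙ presheafToSheaf K (Type v) ≅ G i) := by
  obtain ⟨φ, hφ⟩ := exists_comparison G θ i
  have (P : (C i)ᵒᵖ ⥤ Type v) : IsIso ((presheafToSheaf K (Type v)).map (φ.app P)) :=
    (K.W_iff _).1 (W_comparison G θ (φ.app P) (hφ P))
  have : IsIso (Functor.whiskerRight φ (presheafToSheaf K (Type v))) := by
    have (P : (C i)ᵒᵖ ⥤ Type v) : IsIso ((Functor.whiskerRight φ (presheafToSheaf K (Type v))).app P) := this P
    exact NatIso.isIso_of_isIso_app _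
  exact ⟨asIso (Functor.whiskerRight φ (presheafToSheaf K (Type v))) ≪≫
    Functor.isoWhiskerLeft (G i) (asIso (sheafificationAdjunction K (Type v)).counit)⟩

end Comparison

/-! ### Covering sieves of the join of the topologies -/

section Join

variable {n : ℕ} {C : Fin n → Type u} [∀ i, Category.{v} (C i)]
  (J : ∀ i, GrothendieckTopology (C i))

theorem isClosedAt_iff (i : Fin n) {X : ∀ i, C i} (S : Sieve X) :
    IsClosedAt J i S ↔
      ∀ ⦃Y : ∀ i, C i⦄ (f : Y ⟶ X), S.pullback f ∈ inducedTopology J i Y → S f :=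
  Iff.rfl

theorem IsClosedAt.pullback {i : Fin n} {X Y : ∀ i, C i} {S : Sieve X} (hS : IsClosedAt J i S)
    (f : Y ⟶ X) : IsClosedAt J i (S.pullback f) := by
  rw [isClosedAt_iff] at hS ⊢
  intro Z g hg
  exact hS (g ≫ f) (by rwa [Sieve.pullback_comp])

/-- The topology whose covering sieves are those which generate the maximal sieve
under the closure operations of the `J i`, stably under pullback. -/
def closureTopology : GrothendieckTopology (∀ i, C i) where
  sieves X := {S | ∀ ⦃Y : ∀ i, C i⦄ (f : Y ⟶ X) (T : Sieve Y), S.pullback f ≤ T →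
    (∀ i, IsClosedAt J i T) → T = ⊤}
  top_mem' X Y f T hT _ := top_le_iff.1 (by simpa using hT)
  pullback_stable' X Y S g hS Z f T hT := hS (f ≫ g) T (by rwa [Sieve.pullback_comp])
  -- For `g` in the pullback of `S`, the closed sieve `T.pullback g` contains a pullback of `R`, so
  -- it is maximal and `g` lies in `T`. Thus `T` contains the pullback of `S`.
  transitive' X S hS R hR Y f T hT hT' := hS f T (fun Z g hg => by
    have := hR hg (𝟙 Z) (T.pullback g)
      (by
        intro W k hk
        refine hT _ ?_
        simpa using hk)
      (fun i => (hT' i).pullback J g)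
    rw [← Sieve.id_mem_iff_eq_top] at this
    simpa using this) hT'

theorem inducedTopology_le_closureTopology (i : Fin n) :
    inducedTopology J i ≤ closureTopology J := by
  intro X S hS Y f T hT hT'
  rw [← Sieve.id_mem_iff_eq_top]
  refine (isClosedAt_iff J i T).1 (hT' i) _ ?_
  rw [Sieve.pullback_id]
  exact (inducedTopology J i).superset_covering hT ((inducedTopology J i).pullback_stable f hS)

theorem inducedTopology_le_joinTopology (i : Fin n) :
    inducedTopology J i ≤ joinTopology J :=
  le_sInf fun _ hT => hT i

theorem mem_joinTopology_iff (X : ∀ i, C i) (S : Sieve X) :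
    S ∈ joinTopology J X ↔ ∀ S' : Sieve X, (S ≤ S' ∧ ∀ i, IsClosedAt J i S') ↔ S' = ⊤ := by
  constructor
  · intro hS S'
    constructor
    · rintro ⟨h, h'⟩
      have hS' : S ∈ closureTopology J X :=
        (sInf_le (inducedTopology_le_closureTopology J) : joinTopology J ≤ _) X hS
      exact hS' (𝟙 X) S' (by rwa [Sieve.pullback_id]) h'
    · rintro rfl
      exact ⟨le_top, fun i Y f _ => trivial⟩
  · intro h
    -- Being closed for the join implies `J i`-closed, since the join contains each induced
    -- topology.
    let S' : Sieve X := (joinTopology J).close S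
    have hS' : S' = ⊤ := (h S').1 ⟨(joinTopology J).le_close S, fun i => by
      rw [isClosedAt_iff]
      intro Y f hf
      exact (joinTopology J).isClosed_iff_close_eq_self S' |>.2 ((joinTopology J).close_close S)
        f (inducedTopology_le_joinTopology J i Y hf)⟩
    exact ((joinTopology J).close_eq_top_iff_mem S).1 hS'

end Join

/-! ### Natural transformations between functors on presheaves on a product -/

section NatTrans

variable {n : ℕ} {C : Fin n → Type u} [∀ i, Category.{v} (C i)] {E : Type w} [Category.{w'} E]

/-- The projection of the presheaf represented by `X` to the one represented by `X i`. -/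
def yonedaProj (X : ∀ i, C i) (i : Fin n) :
    yoneda.obj X ⟶ (pullbackEval C i).obj (yoneda.obj (X i)) where
  app Z := ↾fun f => f i

/-- A presheaf represented by `X` is the product of those represented by the `X i`. -/
def isLimitYonedaProj (X : ∀ i, C i) : IsLimit (Fan.mk (yoneda.obj X) (yonedaProj X)) :=
  Fan.IsLimit.mk _
    (fun s => { app Z := ↾fun x i => (s.proj i).app Z x
                naturality Z W g := by
                  ext x
                  funext i
                  exact NatTrans.naturality_apply (s.proj i) g x })
    (fun s i => rfl)
    (fun s m hm => by
      ext Z x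
      funext i
      exact ConcreteCategory.congr_hom (NatTrans.congr_app (hm i) Z) x)

theorem map_yonedaProj {X Z : ∀ i, C i} (g : Z ⟶ X) (i : Fin n) :
    yoneda.map g ≫ yonedaProj X i =
      yonedaProj Z i ≫ (pullbackEval C i).map (yoneda.map (g i)) := rfl

theorem yonedaProj_comp_symm {P : (C i)ᵒᵖ ⥤ Type v} {X : ∀ i, C i} (p : P.obj (op (X i))) :
    yonedaProj X i ≫ (pullbackEval C i).map (yonedaEquiv.symm p) =
      (yonedaEquiv (F := (pullbackEval C i).obj P)).symm p := rfl

variable {Φ Ψ : ((∀ i, C i)ᵒᵖ ⥤ Type v) ⥤ E} [Φ.IsLeftAdjoint] [PreservesFiniteLimits Ψ]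

theorem hom_ext_map_yonedaProj {X : ∀ i, C i} {M : E} {a b : M ⟶ Ψ.obj (yoneda.obj X)}
    (h : ∀ i, a ≫ Ψ.map (yonedaProj X i) = b ≫ Ψ.map (yonedaProj X i)) : a = b :=
  Fan.IsLimit.hom_ext (isLimitFanMkObjOfIsLimit Ψ _ _ (isLimitYonedaProj X)) _ _ h

theorem natTrans_ext_of_pullbackEval {γ γ' : Φ ⟶ Ψ}
    (h : ∀ i, Functor.whiskerLeft (pullbackEval C i) γ = Functor.whiskerLeft (pullbackEval C i) γ') :
    γ = γ' := by
  refine natTrans_ext_of_isLeftAdjoint fun X => hom_ext_map_yonedaProj fun i => ?_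
  rw [← γ.naturality, ← γ'.naturality]
  exact congrArg _ (NatTrans.congr_app (h i) (yoneda.obj (X i)))

/-- On a representable, the `δ i` assemble through the finite product preserved by `Ψ`; since `Φ` is
a left adjoint, the result extends to all presheaves. -/
theorem exists_natTrans_of_pullbackEval
    (δ : ∀ i, pullbackEval C i ⋙ Φ ⟶ pullbackEval C i ⋙ Ψ) :
    ∃ γ : Φ ⟶ Ψ, ∀ i, Functor.whiskerLeft (pullbackEval C i) γ = δ i := by
  let hlim (X : ∀ i, C i) := isLimitFanMkObjOfIsLimit Ψ _ _ (isLimitYonedaProj X)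
  have h (X : ∀ i, C i) : ∃ l : Φ.obj (yoneda.obj X) ⟶ Ψ.obj (yoneda.obj X),
      ∀ i, l ≫ Ψ.map (yonedaProj X i) =
        Φ.map (yonedaProj X i) ≫ (δ i).app (yoneda.obj (X i)) :=
    ⟨Fan.IsLimit.lift (hlim X) fun i => Φ.map (yonedaProj X i) ≫ (δ i).app (yoneda.obj (X i)),
      fun i => Fan.IsLimit.fac (hlim X) _ i⟩
  choose l hl using h
  obtain ⟨γ, hγ⟩ := exists_natTrans_of_isLeftAdjoint (L := Φ) (L' := Ψ)
    { app := l
      naturality := fun Z X g => by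
        refine hom_ext_map_yonedaProj fun i => ?_
        dsimp
        rw [Category.assoc, hl, ← Φ.map_comp_assoc, Category.assoc, ← Ψ.map_comp, map_yonedaProj,
          Φ.map_comp_assoc, Ψ.map_comp, reassoc_of% (hl Z i)]
        exact congrArg _ ((δ i).naturality (yoneda.map (g i))) }
  refine ⟨γ, fun i => ?_⟩
  ext P
  refine hom_ext_of_isLeftAdjoint (L := Φ) (P := (pullbackEval C i).obj P) fun X p => ?_
  have h₁ := (δ i).naturality ((yonedaEquiv (X := X i) (F := P)).symm p)
  have h₂ := γ.naturality ((yonedaEquiv (X := X) (F := (pullbackEval C i).obj P)).symm p)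
  refine h₂.trans ?_
  rw [hγ]
  have h₃ : ∀ k, yonedaProj X i ≫ (pullbackEval C i).map (yonedaEquiv.symm p) = k →
      l X ≫ Ψ.map k = Φ.map k ≫ (δ i).app P := by
    rintro _ rfl
    rw [Ψ.map_comp, Φ.map_comp_assoc, reassoc_of% (hl X i)]
    exact congrArg _ h₁.symm
  exact h₃ _ (yonedaProj_comp_symm p)

end NatTrans

/-! ### The universal property -/

/-- An isomorphism of inverse image functors is an isomorphism of morphisms of toposes. -/
def GeomMorph.isoMk {E : Type*} [Category* E] {F : Type*} [Category* F] {f g : GeomMorph E F}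
    (e : f.inverseImage ≅ g.inverseImage) : f ≅ g where
  hom := ⟨e.hom⟩
  inv := ⟨e.inv⟩
  hom_inv_id := InducedCategory.hom_ext e.hom_inv_id
  inv_hom_id := InducedCategory.hom_ext e.inv_hom_id

/-- The sheaf condition for `S` says that every sheaf is orthogonal to the inclusion of `S`. -/
theorem isIso_presheafToSheaf_map_functorInclusion {C : Type u} [Category.{v} C]
    {J : GrothendieckTopology C} [HasSheafify J (Type v)] {X : C} {S : Sieve X} (hS : S ∈ J X) :
    IsIso ((presheafToSheaf J (Type v)).map S.functorInclusion) := by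
  rw [← J.W_iff]
  intro Z hZ
  have h := (isSheaf_iff_isSheaf_of_type _ _).1 hZ S hS
  rw [Presieve.isSheafFor_iff_yonedaSheafCondition] at h
  refine ⟨fun a b hab => (h _).unique rfl hab.symm, fun f => (h f).exists⟩

section

variable {n : ℕ} {C : Fin n → Type u} [∀ i, Category.{v} (C i)]
  [∀ i, EssentiallySmall.{v} (C i)] (J : ∀ i, GrothendieckTopology (C i))

attribute [local instance] hasSheafify

/-- Inverse image along the `i`-th projection commutes with sheafification. -/
theorem nonempty_presheafToSheaf_comp_projection_iso (i : Fin n) :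
    Nonempty (presheafToSheaf (J i) (Type v) ⋙ (projection J i).inverseImage ≅
      pullbackEval C i ⋙ presheafToSheaf (joinTopology J) (Type v)) := by
  have := hasRan (Pi.eval C i)
  have : PreservesFiniteLimits (pullbackEval C i) := ⟨fun _ _ _ => inferInstance⟩
  have := comp_preservesFiniteLimits (pullbackEval C i)
    (presheafToSheaf (joinTopology J) (Type v))
  exact ⟨presheafToSheafCompIso
    (((Pi.eval C i).op.ranAdjunction (Type v)).comp
      (sheafificationAdjunction (joinTopology J) (Type v))) (J i)
    fun M => (((Pi.eval C i).sheafPushforwardCocontinuous (Type v) (joinTopology J) (J i)).obj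
      M).property⟩

variable {E : Type w} [Category.{w'} E]

theorem isLeftAdjoint_and_preservesFiniteLimits_comp
    {A : Type u} [Category.{v} A] (J : GrothendieckTopology A) [HasSheafify J (Type v)]
    (f : GeomMorph E (Sheaf J (Type v))) :
    (presheafToSheaf J (Type v) ⋙ f.inverseImage).IsLeftAdjoint ∧
      PreservesFiniteLimits (presheafToSheaf J (Type v) ⋙ f.inverseImage) :=
  have := f.preservesFiniteLimits
  ⟨((sheafificationAdjunction J (Type v)).comp f.adj).isLeftAdjoint,
    comp_preservesFiniteLimits _ _⟩

variable (E) in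
theorem faithful_postcomp_projection :
    (Functor.pi' fun i => GeomMorph.postcomp E (projection J i)).Faithful where
  map_injective {f g α β} h := by
    have hi (i) : Functor.whiskerLeft (projection J i).inverseImage α.hom =
        Functor.whiskerLeft (projection J i).inverseImage β.hom :=
      congrArg (fun k => (k i).hom) h
    obtain ⟨hf, -⟩ := isLeftAdjoint_and_preservesFiniteLimits_comp (joinTopology J) f
    obtain ⟨-, hg⟩ := isLeftAdjoint_and_preservesFiniteLimits_comp (joinTopology J) g
    have := Localization.faithful_whiskeringLeft (presheafToSheaf (joinTopology J) (Type v))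
      (joinTopology J).W E
    refine InducedCategory.hom_ext (((Functor.whiskeringLeft _ _ E).obj
      (presheafToSheaf (joinTopology J) (Type v))).map_injective ?_)
    refine natTrans_ext_of_pullbackEval
      (Φ := presheafToSheaf (joinTopology J) (Type v) ⋙ f.inverseImage)
      (Ψ := presheafToSheaf (joinTopology J) (Type v) ⋙ g.inverseImage) fun i => ?_
    obtain ⟨κ⟩ := nonempty_presheafToSheaf_comp_projection_iso J i
    ext P
    change α.hom.app _ = β.hom.app _
    -- Conjugating by `κ` replaces the sheafified pullback of `P` by the inverse image of its
    -- sheafification, where `hi` applies.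
    rw [← cancel_epi (f.inverseImage.map (κ.hom.app P))]
    refine (α.hom.naturality (κ.hom.app P)).trans
      (Eq.trans ?_ (β.hom.naturality (κ.hom.app P)).symm)
    exact congrArg (· ≫ _) (NatTrans.congr_app (hi i) ((presheafToSheaf (J i) (Type v)).obj P))

variable (E) in
theorem full_postcomp_projection :
    (Functor.pi' fun i => GeomMorph.postcomp E (projection J i)).Full where
  map_surjective {f g} β := by
    obtain ⟨hf, -⟩ := isLeftAdjoint_and_preservesFiniteLimits_comp (joinTopology J) f
    obtain ⟨-, hg⟩ := isLeftAdjoint_and_preservesFiniteLimits_comp (joinTopology J) g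
    have := Localization.full_whiskeringLeft (presheafToSheaf (joinTopology J) (Type v))
      (joinTopology J).W E
    have κ (i) := (nonempty_presheafToSheaf_comp_projection_iso J i).some
    let β' (i) : (projection J i).inverseImage ⋙ f.inverseImage ⟶
      (projection J i).inverseImage ⋙ g.inverseImage := (β i).hom
    obtain ⟨γ, hγ⟩ := exists_natTrans_of_pullbackEval
      (Φ := presheafToSheaf (joinTopology J) (Type v) ⋙ f.inverseImage)
      (Ψ := presheafToSheaf (joinTopology J) (Type v) ⋙ g.inverseImage)
      fun i => Functor.whiskerRight (κ i).inv f.inverseImage ≫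
        Functor.whiskerLeft (presheafToSheaf (J i) (Type v)) (β' i) ≫
        Functor.whiskerRight (κ i).hom g.inverseImage
    obtain ⟨α, rfl⟩ := ((Functor.whiskeringLeft _ _ E).obj
      (presheafToSheaf (joinTopology J) (Type v))).map_surjective γ
    refine ⟨⟨α⟩, ?_⟩
    funext i
    refine InducedCategory.hom_ext ?_
    have := Localization.faithful_whiskeringLeft (presheafToSheaf (J i) (Type v)) (J i).W E
    refine ((Functor.whiskeringLeft _ _ E).obj
      (presheafToSheaf (J i) (Type v))).map_injective ?_
    ext P
    change α.app _ = (β' i).app _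
    have h₁ : α.app _ = f.inverseImage.map ((κ i).inv.app P) ≫ (β' i).app _ ≫
      g.inverseImage.map ((κ i).hom.app P) := NatTrans.congr_app (hγ i) P
    rw [← cancel_mono (g.inverseImage.map ((κ i).hom.app P))]
    refine (α.naturality _).symm.trans ?_
    rw [h₁, ← Functor.map_comp_assoc]
    simp

theorem essSurj_postcomp_projection (hE : IsTopos.{v} E) :
    (Functor.pi' fun i => GeomMorph.postcomp E (projection J i)).EssSurj where
  mem_essImage f := by
    obtain ⟨D, _, K, ⟨e⟩⟩ := hE
    let G (i) : ((C i)ᵒᵖ ⥤ Type v) ⥤ Sheaf K (Type v) :=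
      (presheafToSheaf (J i) (Type v) ⋙ (f i).inverseImage) ⋙ e.functor
    have h (i) := isLeftAdjoint_and_preservesFiniteLimits_comp (J i) (f i)
    have _ (i) : (presheafToSheaf (J i) (Type v) ⋙ (f i).inverseImage).IsLeftAdjoint := (h i).1
    have hG (i) : (G i).IsLeftAdjoint := inferInstanceAs (Functor.IsLeftAdjoint (_ ⋙ _))
    have hG' (i) : PreservesFiniteLimits (G i) :=
      have := (h i).2
      comp_preservesFiniteLimits _ _
    have hJ (i) (X : C i) (S : Sieve X) (hS : S ∈ J i X) :
        IsIso ((G i).map S.functorInclusion) :=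
      have := isIso_presheafToSheaf_map_functorInclusion hS
      inferInstanceAs (IsIso (e.functor.map ((f i).inverseImage.map
        ((presheafToSheaf (J i) (Type v)).map S.functorInclusion))))
    obtain ⟨L, _, ⟨θ⟩⟩ := exists_leftAdjoint_extension
      (piFunctor fun i => yoneda ⋙ G i ⋙ sheafToPresheaf K (Type v))
    have := (locallyFlat_extension G θ).preservesFiniteLimits
    have := comp_preservesFiniteLimits (L ⋙ presheafToSheaf K (Type v)) e.inverse
    let adj := ((Adjunction.ofIsLeftAdjoint L).comp
      (sheafificationAdjunction K (Type v))).comp e.symm.toAdjunction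
    have hR := isSheaf_joinTopology J G θ hJ e.inverse adj
    refine ⟨geomMorphOfPresheaf adj (joinTopology J) hR, ⟨Pi.isoMk fun i => GeomMorph.isoMk ?_⟩⟩
    let ι := (sheafToPresheaf (J i) (Type v))
    let κ := presheafToSheafCompIso adj (joinTopology J) hR
    let ψ := (nonempty_pullbackEval_comp_iso G θ i).some
    -- In order: drop the join sheafification, identify the restriction with `G i`, cancel the
    -- equivalence `e`, and cancel sheafification on sheaves.
    exact Functor.isoWhiskerLeft (ι ⋙ pullbackEval C i) κ ≪≫
      Functor.isoWhiskerLeft ι (Functor.isoWhiskerRight ψ e.inverse) ≪≫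
      Functor.isoWhiskerLeft (ι ⋙ presheafToSheaf (J i) (Type v) ⋙ (f i).inverseImage)
        e.unitIso.symm ≪≫
      Functor.isoWhiskerRight (asIso (sheafificationAdjunction (J i) (Type v)).counit)
        (f i).inverseImage ≪≫ (f i).inverseImage.leftUnitor

end

end ToposProduct

theorem mainTheorem9 {n : ℕ} {C : Fin n → Type u} [∀ i, Category.{v} (C i)]
    [∀ i, EssentiallySmall.{v} (C i)] (J : ∀ i, GrothendieckTopology (C i)) :
    (∀ (X : ∀ i, C i) (S : Sieve X),
      S ∈ ToposProduct.joinTopology J X ↔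
        ∀ S' : Sieve X, (S ≤ S' ∧ ∀ i, ToposProduct.IsClosedAt J i S') ↔ S' = ⊤) ∧
    ToposProduct.IsTopos.{v} (Sheaf (ToposProduct.joinTopology J) (Type v)) ∧
    ∀ (E : Type w) [Category.{w'} E], ToposProduct.IsTopos.{v} E →
      (Functor.pi' fun i =>
        ToposProduct.GeomMorph.postcomp E (ToposProduct.projection J i)).IsEquivalence :=
  ⟨ToposProduct.mem_joinTopology_iff J, ToposProduct.isTopos_sheaf _, fun E _ hE =>
    { faithful := ToposProduct.faithful_postcomp_projection J E
      full := ToposProduct.full_postcomp_projection J E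
      essSurj := ToposProduct.essSurj_postcomp_projection J hE }⟩
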